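/- **Setting.** Pauli operators are taken modulo phase. A stabilizer code on a finite set of qubits is given by a finite family of pairwise commuting Pauli checks (not necessarily CSS). Logical operators are the Paulis commuting with all checks; they are nontrivial if they are not a product of checks; the distance is the least weight of a nontrivial logical operator. The code is $(a,b)$-LDPC if each check acts on at most $a$ qubits and each qubit is acted upon by at most $b$ checks. After a choice of local bases, the two operators to be measured are nontrivial $Z$-type logical operators $\overline Z_l=Z(\mathcal L_l)$, $\overline Z_r=Z(\mathcal L_r)$ of LDPC codes; they may belong to the same codeblock or to separate ones. **Joint measurement.** One chooses a connected auxiliary graph $\mathcal G=(\mathcal V,\mathcal E)$, injective port functions $f_l:\mathcal L_l\to\mathcal V$ and $f_r:\mathcal L_r\to\mathcal V$ (whose images may overlap) and a cycle basis of $\mathcal G$. The deformed code has one additional qubit for each edge, and the following checks: for each vertex $v$, the product of $Z$ on the edges incident to $v$, on the qubit $q\in\mathcal L_l$ with $f_l(q)=v$ (if any) and on the qubit $q\in\mathcal L_r$ with $f_r(q)=v$ (if any); for each cycle in the basis, the product of $X$ on its edges; and each original check $s$, multiplied by $X$ on a set of edges whose boundary is the mod-2 sum of the ports of those qubits of $\mathcal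 L_l$ and $\mathcal L_r$ on which $s$ acts as $X$ or $Y$ (checks that do not act as $X$ or $Y$ on $\mathcal L_l\cup\mathcal L_r$ are unchanged). **Theorem.** For all $a,b$ there are constants $K,a',b'$, depending only on $a,b$, such that for all $(a,b)$-LDPC codes and operators $\overline Z_l,\overline Z_r$ as above, with $D=\max(|\overline Z_l|,|\overline Z_r|)$, there is such an auxiliary graph (with no expansion required) with the following properties. 1. The graph has $O(D\log^3 D)$ vertices and edges, precisely $|\mathcal V|+|\mathcal E|\le K\,D\,(\log(D+1))^3$. 2. The deformed code is $(a',b')$-LDPC. 3. Only $\overline Z_l\overline Z_r$ is measured: $\overline Z_l\overline Z_r$ is a stabilizer of the deformed code; a Pauli $P$ on the original qubits is, up to multiplication by $X$ operators on edge qubits, a stabilizer of the deformed code if and only if it is a product of original checks and possibly $\overline Z_l\overline Z_r$; each original logical operator commuting with $\overline Z_l\overline Z_r$ becomes a logical operator of the deformed code after multiplication by $X$ operators on edge qubits; and, if $\overline Z_l\overline Z_r$ is not an original stabilizer, the deformed code has exactly one logical qubit less than the original code. If $\overline Z_l$ and $\overline Z_r$ belong to separate codeblocks with distances $d_l$ and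 $d_r$, the graph can be chosen so that, in addition, the deformed code has distance at least $d_l+d_r-D$; and, if moreover one of $\overline Z_l,\overline Z_r$ has weight $D$ and has minimum weight among the nontrivial logical operators of its code (if $|\overline Z_l|=|\overline Z_r|$, it is enough that one of the two has minimum weight), then this deformed code has distance at least $\min(d_l,d_r)$. -/

import Mathlib

namespace QSurgery

/-- An `n`-qubit Pauli operator modulo phase, on the qubits `Q`, as its symplectic vector
`[x | z]` over the field with two elements; multiplication of operators is addition of vectors. -/
abbrev Pauli (Q : Type) : Type := (Q → ZMod 2) × (Q → ZMod 2)

/-- The qubits on which a Pauli operator acts as `X`, `Y` or `Z`. -/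
def support {Q : Type} (P : Pauli Q) : Set Q := {q | P.1 q ≠ 0 ∨ P.2 q ≠ 0}

/-- The Pauli weight. -/
noncomputable def weight {Q : Type} (P : Pauli Q) : ℕ := (support P).ncard

/-- The symplectic form; it vanishes exactly when the two operators commute. -/
def symp {Q : Type} [Fintype Q] (P R : Pauli Q) : ZMod 2 :=
  ∑ q, (P.1 q * R.2 q + P.2 q * R.1 q)

/-- The `Z`-type operator `Z(L)`. -/
def zOn {Q : Type} [DecidableEq Q] (L : Finset Q) : Pauli Q :=
  (0, fun q => if q ∈ L then 1 else 0)

/-- A stabilizer code (not necessarily CSS) on the qubits `Q`, given by pairwise commuting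
checks indexed by `S` (possibly redundant). -/
structure StabilizerCode (Q S : Type) [Fintype Q] [Fintype S] where
  check : S → Pauli Q
  comm : ∀ s t, symp (check s) (check t) = 0

namespace StabilizerCode

variable {Q S : Type} [Fintype Q] [Fintype S]

/-- The stabilizer group: all products of checks. -/
def stabilizer (C : StabilizerCode Q S) : Submodule (ZMod 2) (Pauli Q) :=
  Submodule.span (ZMod 2) (Set.range C.check)

/-- Logical operators are the Pauli operators that commute with all the checks. -/
def IsLogical (C : StabilizerCode Q S) (P : Pauli Q) : Prop :=
  ∀ s, symp P (C.check s) = 0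

/-- Nontrivial logical operators: those that are not a product of checks. -/
def IsNontrivialLogical (C : StabilizerCode Q S) (P : Pauli Q) : Prop :=
  C.IsLogical P ∧ P ∉ C.stabilizer

/-- The code distance: the least weight of a nontrivial logical operator. -/
noncomputable def distance (C : StabilizerCode Q S) : ℕ :=
  sInf {w | ∃ P, C.IsNontrivialLogical P ∧ weight P = w}

/-- The number of logical qubits: number of qubits minus number of independent checks. -/
noncomputable def numLogical (C : StabilizerCode Q S) : ℕ :=
  Fintype.card Q - Module.finrank (ZMod 2) C.stabilizer

/-- `(a, b)`-LDPC: each check acts on at most `a` qubits, and each qubit is acted upon by at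
most `b` checks. -/
def IsLDPC (C : StabilizerCode Q S) (a b : ℕ) : Prop :=
  (∀ s, weight (C.check s) ≤ a) ∧ ∀ q, {s | q ∈ support (C.check s)}.ncard ≤ b

/-- Two separate codeblocks regarded as one code. -/
def sum {Q₁ S₁ Q₂ S₂ : Type} [Fintype Q₁] [Fintype S₁] [Fintype Q₂] [Fintype S₂]
    (C₁ : StabilizerCode Q₁ S₁) (C₂ : StabilizerCode Q₂ S₂) :
    StabilizerCode (Q₁ ⊕ Q₂) (S₁ ⊕ S₂) where
  check := Sum.elim
    (fun s => (Sum.elim (C₁.check s).1 0, Sum.elim (C₁.check s).2 0))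
    (fun s => (Sum.elim 0 (C₂.check s).1, Sum.elim 0 (C₂.check s).2))
  comm := by
    rintro (s | s) (t | t)
    · simpa [symp] using C₁.comm s t
    · simp [symp]
    · simp [symp]
    · simpa [symp] using C₂.comm s t

end StabilizerCode

/-- The incidence matrix of a graph: rows are edges, columns are vertices. -/
def incidence {V : Type} [DecidableEq V] (G : SimpleGraph V) : Matrix G.edgeSet V (ZMod 2) :=
  fun e v => if v ∈ (e : Sym2 V) then 1 else 0

/-- The matrix of a port function `f` on the qubit set `L`: the entry at `(v, q)` is `1` exactly
when `q ∈ L` and `f q = v`. -/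
def portMatrix {Q V : Type} [DecidableEq Q] [DecidableEq V] (L : Finset Q) (f : Q → V) :
    Matrix V Q (ZMod 2) :=
  fun v q => if q ∈ L ∧ f q = v then 1 else 0

/-- The data of auxiliary graph surgery for the joint measurement of `Z(Ll) Z(Lr)` on a code `C`:
a connected graph, one port function for each of the two operators (only their values on `Ll`,
respectively `Lr`, matter; one vertex may be a port for a qubit of `Ll` and a qubit of `Lr` at the
same time), the matching that deforms each check, and a cycle basis. -/
structure JointSurgery {Q S : Type} [Fintype Q] [DecidableEq Q] [Fintype S]
    (C : StabilizerCode Q S) (Ll Lr : Finset Q) where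
  V : Type
  [fintypeV : Fintype V]
  [decEqV : DecidableEq V]
  graph : SimpleGraph V
  [decAdj : DecidableRel graph.Adj]
  connected : graph.Connected
  portL : Q → V
  portR : Q → V
  portL_inj : Set.InjOn portL Ll
  portR_inj : Set.InjOn portR Lr
  /-- the set of edges whose `X` operators are multiplied to a check of the original code -/
  matching : S → graph.edgeSet → ZMod 2
  /-- the boundary of the matching consists of the ports of the qubits where the check acts
  as `X` or `Y` -/
  matching_boundary : ∀ s, Matrix.vecMul (matching s) (incidence graph) =
    Matrix.mulVec (portMatrix Ll portL + portMatrix Lr portR) (C.check s).1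
  /-- checks without `X`-type support on the measured operators are not deformed -/
  matching_eq_zero : ∀ s, (∀ q ∈ Ll ∪ Lr, (C.check s).1 q = 0) → matching s = 0
  U : Type
  [fintypeU : Fintype U]
  cycle : U → graph.edgeSet → ZMod 2
  cycle_independent : LinearIndependent (ZMod 2) cycle
  /-- the rows `cycle u` span the cycle space -/
  cycle_span : ∀ c : graph.edgeSet → ZMod 2,
    c ∈ Submodule.span (ZMod 2) (Set.range cycle) ↔ Matrix.vecMul c (incidence graph) = 0

attribute [instance] JointSurgery.fintypeV JointSurgery.decEqV JointSurgery.decAdj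
  JointSurgery.fintypeU

namespace JointSurgery

variable {Q S : Type} [Fintype Q] [DecidableEq Q] [Fintype S]
  {C : StabilizerCode Q S} {Ll Lr : Finset Q}

/-- The size of the auxiliary graph: its number of vertices and edges. -/
def size (A : JointSurgery C Ll Lr) : ℕ := Fintype.card A.V + Fintype.card A.graph.edgeSet

/-- The operator `P ⊗ X(c)`, with `P` on the original qubits and `X(c)` on the edge qubits. -/
def withEdges (A : JointSurgery C Ll Lr) (P : Pauli Q) (c : A.graph.edgeSet → ZMod 2) :
    Pauli (Q ⊕ A.graph.edgeSet) :=
  (Sum.elim P.1 c, Sum.elim P.2 0)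

/-- The `Z`-type vertex check: `Z` on the qubits attached to the vertex and on the incident
edges. -/
def vertexCheck (A : JointSurgery C Ll Lr) (v : A.V) : Pauli (Q ⊕ A.graph.edgeSet) :=
  (0, Sum.elim ((portMatrix Ll A.portL + portMatrix Lr A.portR) v)
    (fun e => incidence A.graph e v))

/-- The checks of the deformed code: deformed original checks, vertex checks, cycle checks. -/
def deformedCheck (A : JointSurgery C Ll Lr) : S ⊕ A.V ⊕ A.U → Pauli (Q ⊕ A.graph.edgeSet)
  | Sum.inl s => A.withEdges (C.check s) (A.matching s)
  | Sum.inr (Sum.inl v) => A.vertexCheck v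
  | Sum.inr (Sum.inr u) => A.withEdges 0 (A.cycle u)

theorem symp_comm {R : Type} [Fintype R] (P P' : Pauli R) : symp P P' = symp P' P := by
  unfold symp
  exact Finset.sum_congr rfl fun q _ => by ring

theorem symp_check_vertex (A : JointSurgery C Ll Lr) (s : S) (v : A.V) :
    symp (A.withEdges (C.check s) (A.matching s)) (A.vertexCheck v) = 0 := by
  have h := congrFun (A.matching_boundary s) v
  simp only [Matrix.vecMul, Matrix.mulVec, dotProduct] at h
  simp only [symp, withEdges, vertexCheck, Fintype.sum_sum_type, Sum.elim_inl, Sum.elim_inr,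
    Pi.zero_apply, mul_zero, add_zero, h]
  rw [← Finset.sum_add_distrib]
  refine Finset.sum_eq_zero fun q _ => ?_
  rw [mul_comm]
  exact CharTwo.add_self_eq_zero _

theorem symp_cycle_vertex (A : JointSurgery C Ll Lr) (u : A.U) (v : A.V) :
    symp (A.withEdges 0 (A.cycle u)) (A.vertexCheck v) = 0 := by
  have h := congrFun ((A.cycle_span (A.cycle u)).1 (Submodule.subset_span ⟨u, rfl⟩)) v
  simp only [Matrix.vecMul, dotProduct] at h
  simpa [symp, withEdges, vertexCheck] using h

/-- The deformed code. -/
def deformed (A : JointSurgery C Ll Lr) :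
    StabilizerCode (Q ⊕ A.graph.edgeSet) (S ⊕ A.V ⊕ A.U) where
  check := A.deformedCheck
  comm := by
    rintro (s | v | u) (t | w | x)
    · simpa [symp, deformedCheck, withEdges] using C.comm s t
    · exact A.symp_check_vertex s w
    · simp [symp, deformedCheck, withEdges]
    · rw [symp_comm]; exact A.symp_check_vertex t v
    · simp [symp, deformedCheck, vertexCheck]
    · rw [symp_comm]; exact A.symp_cycle_vertex x v
    · simp [symp, deformedCheck, withEdges]
    · exact A.symp_cycle_vertex u w
    · simp [symp, deformedCheck, withEdges]

/-- The surgery measures `Z(Ll) Z(Lr)` and no other logical operator. Recall that the edge qubits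
start in the state stabilized by all `X(e)`, so that `P` on the original qubits is measured exactly
when some `P ⊗ X(c)` is a stabilizer of the deformed code.
* `Z(Ll) Z(Lr)` is a stabilizer of the deformed code;
* the operators on the original qubits whose value is known in the deformed code are exactly the
  products of original stabilizers and `Z(Ll) Z(Lr)`;
* each original logical operator that commutes with `Z(Ll) Z(Lr)` extends to a logical operator of
  the deformed code;
* exactly one logical qubit is lost, provided that `Z(Ll) Z(Lr)` is not itself a stabilizer. -/
def MeasuresOnlyProduct (A : JointSurgery C Ll Lr) : Prop :=
  A.withEdges (zOn Ll + zOn Lr) 0 ∈ A.deformed.stabilizer ∧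
  (∀ P : Pauli Q, (∃ c, A.withEdges P c ∈ A.deformed.stabilizer) ↔
    P ∈ C.stabilizer ⊔ Submodule.span (ZMod 2) {zOn Ll + zOn Lr}) ∧
  (∀ P : Pauli Q, C.IsLogical P → symp P (zOn Ll + zOn Lr) = 0 →
    ∃ c, A.deformed.IsLogical (A.withEdges P c)) ∧
  (zOn Ll + zOn Lr ∉ C.stabilizer → A.deformed.numLogical + 1 = C.numLogical)

end JointSurgery

end QSurgery

/-! The algebra of the surgery works for every connected auxiliary graph. A sum of vertex checks
over a vertex set `β` acts on the edges as `Z` on the cut of `β`. It is trivial there only for `β`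
constant, and then it is the identity or the measured product, so nothing else is measured.
Conversely, a logical operator that commutes with the product meets the ports evenly, so its port
set is the boundary of an edge set. Since the cut space and the cycle space have complementary
dimensions, exactly one logical qubit is lost (`finrank_deformed_stabilizer`).

The distance bound needs no expansion. A nontrivial logical operator of the deformed code commutes
with all cycles, so its edge `Z`-part is a cut and can be removed by vertex checks, at the price of
`Z` operators on the qubits whose ports lie in `β`. For separate blocks one may keep `β` on one side
and, after multiplication by that block's measured operator, use the complement of `β` on the other.
One of the two choices leaves nontrivial logical operators in both blocks. If all ports lie in one
set `B`, the added weight is at most `|B|`, because opposite sides of the cut are used. Sending both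
operators into the same `D` vertices gives the loss `D`.

It remains to find a sparse graph with adjacent ports for qubits in a common check and with a sparse
cycle basis. The required adjacencies are covered by boundedly many permutations of the vertices of
a cube of dimension `m = clog 2 D`. Each is factored by a Beneš network: stages `s 0 = id, ..., s m`
interpolate to it, and consecutive stages differ by flips of one coordinate on either side. The
graph has `m + 1` copies of the cube; layer `i` carries the edges of `s i`, of `s (i + 1)`, of flips
in direction `i`, and of a Gray code in directions up to `i`. A stage edge is moved to the adjacent
layer by a vertical square and replaced by the preceding stage through a square of flips. Gray edges
suffice to connect the lower subcubes while keeping the degree bounded. Hence closed walks of length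
at most four generate all cycles (`exists_layer_potential`, `isFilled_routingGraph`), and a basis
chosen among them is sparse on both sides. The graph has only `O(D log D)` vertices and edges, for
fixed `a` and `b`. -/

namespace QSurgery

open Matrix

/-! ### The symplectic form -/

theorem zmod2_eq_one_of_ne_zero {x : ZMod 2} (h : x ≠ 0) : x = 1 := by
  revert x; decide

theorem zmod2_add_eq_zero_iff {x y : ZMod 2} : x + y = 0 ↔ x = y := by
  revert x y; decide

theorem add_self_eq_zero_of_zmod2 {M : Type*} [AddCommGroup M] [Module (ZMod 2) M] (x : M) :
    x + x = 0 := by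
  rw [← two_smul (ZMod 2) x, show (2 : ZMod 2) = 0 from rfl, zero_smul]

/-- The symplectic form as a bilinear form. -/
def sympForm (Q : Type) [Fintype Q] : LinearMap.BilinForm (ZMod 2) (Pauli Q) :=
  LinearMap.mk₂ (ZMod 2) symp
    (fun P P' R => by
      simp only [symp, ← Finset.sum_add_distrib, Prod.fst_add, Prod.snd_add, Pi.add_apply]
      exact Finset.sum_congr rfl fun q _ => by ring)
    (fun c P R => by
      simp only [symp, Prod.smul_fst, Prod.smul_snd, Pi.smul_apply, smul_eq_mul, Finset.mul_sum]
      exact Finset.sum_congr rfl fun q _ => by ring)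
    (fun P R R' => by
      simp only [symp, ← Finset.sum_add_distrib, Prod.fst_add, Prod.snd_add, Pi.add_apply]
      exact Finset.sum_congr rfl fun q _ => by ring)
    (fun c P R => by
      simp only [symp, Prod.smul_fst, Prod.smul_snd, Pi.smul_apply, smul_eq_mul, Finset.mul_sum]
      exact Finset.sum_congr rfl fun q _ => by ring)

section Symplectic

variable {Q : Type} [Fintype Q]

@[simp] theorem sympForm_apply (P R : Pauli Q) : sympForm Q P R = symp P R := rfl

theorem symp_swap (P R : Pauli Q) : symp P R = symp R P := JointSurgery.symp_comm P R

theorem symp_add_left (P P' R : Pauli Q) : symp (P + P') R = symp P R + symp P' R :=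
  (sympForm Q).map_add₂ P P' R

theorem symp_add_right (P R R' : Pauli Q) : symp P (R + R') = symp P R + symp P R' :=
  (sympForm Q P).map_add R R'

theorem symp_self (P : Pauli Q) : symp P P = 0 := by
  refine Finset.sum_eq_zero fun q _ => ?_
  rw [mul_comm (P.2 q)]
  exact CharTwo.add_self_eq_zero _

/-- The restriction of a Pauli operator to the first block of qubits. -/
def leftPart {Q₁ Q₂ : Type} : Pauli (Q₁ ⊕ Q₂) →ₗ[ZMod 2] Pauli Q₁ where
  toFun P := (fun q => P.1 (Sum.inl q), fun q => P.2 (Sum.inl q))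
  map_add' _ _ := rfl
  map_smul' _ _ := rfl

/-- The restriction of a Pauli operator to the second block of qubits. -/
def rightPart {Q₁ Q₂ : Type} : Pauli (Q₁ ⊕ Q₂) →ₗ[ZMod 2] Pauli Q₂ where
  toFun P := (fun q => P.1 (Sum.inr q), fun q => P.2 (Sum.inr q))
  map_add' _ _ := rfl
  map_smul' _ _ := rfl

theorem sympForm_nondegenerate : (sympForm Q).Nondegenerate := by
  classical
  have hrefl : (sympForm Q).IsRefl := fun P R h => by
    rw [sympForm_apply] at h ⊢; rw [symp_swap]; exact h
  refine (LinearMap.IsRefl.nondegenerate_iff_separatingLeft hrefl).2 fun P hP => ?_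
  ext q
  · simpa [symp, Pi.single_apply] using hP (0, Pi.single q 1)
  · simpa [symp, Pi.single_apply] using hP (Pi.single q 1, 0)

theorem finrank_pauli : Module.finrank (ZMod 2) (Pauli Q) = 2 * Fintype.card Q := by
  rw [Module.finrank_prod, Module.finrank_pi, two_mul]

/-- A space of pairwise commuting Pauli operators has at most one generator per qubit. -/
theorem finrank_le_card_of_isotropic (W : Submodule (ZMod 2) (Pauli Q))
    (hW : ∀ P ∈ W, ∀ R ∈ W, symp P R = 0) : Module.finrank (ZMod 2) W ≤ Fintype.card Q := by
  have h := LinearMap.BilinForm.finrank_orthogonal sympForm_nondegenerate W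
  have hle : W ≤ (sympForm Q).orthogonal W := fun P hP R hR => hW R hR P hP
  have h2 := Submodule.finrank_mono hle
  rw [h, finrank_pauli] at h2
  omega

end Symplectic

/-! ### Edge vectors -/

section Graph

variable {V : Type} [DecidableEq V] (G : SimpleGraph V)

/-- The indicator of the edge between `u` and `v`; it is zero if they are not adjacent. -/
def edgeVec (u v : V) : G.edgeSet → ZMod 2 := fun e => if (e : Sym2 V) = s(u, v) then 1 else 0

theorem edgeVec_swap (u v : V) : edgeVec G u v = edgeVec G v u := by
  ext e; simp [edgeVec, Sym2.eq_swap]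

theorem edgeVec_self (v : V) : edgeVec G v v = 0 := by
  ext e
  have : (e : Sym2 V) ≠ s(v, v) := fun h => by
    have := e.2; rw [h, SimpleGraph.mem_edgeSet] at this; exact G.loopless.irrefl _ this
  simp [edgeVec, this]

theorem edgeVec_eq_single {u v : V} (h : G.Adj u v) :
    edgeVec G u v = Pi.single ⟨s(u, v), h⟩ 1 := by
  ext e
  simp [edgeVec, Pi.single_apply, Subtype.ext_iff]

variable {G} [Fintype V] [DecidableRel G.Adj]

theorem boundary_edgeVec {u v : V} (h : u = v ∨ G.Adj u v) :
    edgeVec G u v ᵥ* incidence G = Pi.single u 1 + Pi.single v 1 := by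
  rcases h with rfl | h
  · rw [edgeVec_self, zero_vecMul, add_self_eq_zero_of_zmod2]
  · rw [edgeVec_eq_single G h]
    ext x
    have hne := h.ne
    simp only [single_one_vecMul, row_apply, incidence, Sym2.mem_iff, Pi.add_apply,
      Pi.single_apply]
    by_cases h1 : x = u <;> by_cases h2 : x = v
    · exact absurd (h1.symm.trans h2) hne
    · simp [h1, hne]
    · simp [h2, hne.symm]
    · simp [h1, h2]

theorem incidence_mulVec (β : V → ZMod 2) {u v : V} (h : G.Adj u v) :
    (incidence G *ᵥ β) ⟨s(u, v), h⟩ = β u + β v := by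
  have h1 : (incidence G *ᵥ β) ⟨s(u, v), h⟩ =
      Pi.single (M := fun _ => ZMod 2) ⟨s(u, v), h⟩ 1 ⬝ᵥ (incidence G *ᵥ β) := by simp
  rw [h1, ← edgeVec_eq_single, dotProduct_mulVec, boundary_edgeVec (Or.inr h), add_dotProduct]
  simp

theorem exists_boundary_pair (hG : G.Connected) (u v : V) :
    ∃ c : G.edgeSet → ZMod 2, c ᵥ* incidence G = Pi.single u 1 + Pi.single v 1 := by
  obtain ⟨p⟩ := hG.preconnected u v
  induction p with
  | nil => exact ⟨0, by rw [zero_vecMul, add_self_eq_zero_of_zmod2]⟩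
  | @cons u w v h p ih =>
    obtain ⟨c, hc⟩ := ih
    refine ⟨edgeVec G u w + c, ?_⟩
    rw [add_vecMul, hc, boundary_edgeVec (Or.inr h)]
    have := add_self_eq_zero_of_zmod2 (Pi.single w 1 : V → ZMod 2)
    calc _ = Pi.single u 1 + (Pi.single w 1 + Pi.single w 1) + Pi.single v (1 : ZMod 2) := by abel
      _ = _ := by rw [this, add_zero]

/-- In a connected graph each even set of vertices is the boundary of a set of edges. -/
theorem exists_boundary (hG : G.Connected) {y : V → ZMod 2} (hy : ∑ v, y v = 0) :
    ∃ c : G.edgeSet → ZMod 2, c ᵥ* incidence G = y := by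
  obtain ⟨r⟩ := hG.nonempty
  choose c hc using fun v => exists_boundary_pair hG v r
  refine ⟨∑ v, y v • c v, ?_⟩
  rw [sum_vecMul]
  simp only [smul_vecMul, hc, smul_add, Finset.sum_add_distrib, ← Finset.sum_smul, hy, zero_smul,
    add_zero]
  ext x
  simp [Finset.sum_apply, Pi.single_apply]

/-- In a connected graph, vertex labels that agree along the edges are constant. -/
theorem eq_of_incidence_mulVec_eq_zero (hG : G.Connected) {β : V → ZMod 2}
    (h : incidence G *ᵥ β = 0) (u v : V) : β u = β v := by
  obtain ⟨p⟩ := hG.preconnected u v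
  induction p with
  | nil => rfl
  | cons hadj p ih =>
    rw [← ih, ← zmod2_add_eq_zero_iff, ← incidence_mulVec β hadj, h]
    rfl

/-- Edge sets that meet each cycle evenly are cuts. -/
theorem exists_cut (z : G.edgeSet → ZMod 2)
    (hz : ∀ c : G.edgeSet → ZMod 2, c ᵥ* incidence G = 0 → c ⬝ᵥ z = 0) :
    ∃ β : V → ZMod 2, z = incidence G *ᵥ β := by
  by_contra! hcon
  have hmem : z ∉ LinearMap.range (incidence G).mulVecLin := by
    rintro ⟨β, rfl⟩
    exact hcon β rfl
  -- A functional separating `z` from the cuts is the pairing with some edge set. As it vanishes on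
  -- cuts, this edge set is a cycle, which contradicts `hz`.
  obtain ⟨f, hfz, hf⟩ := Submodule.exists_le_ker_of_notMem hmem
  have hfc : ∀ y, f y = (fun e => f (Pi.single e 1)) ⬝ᵥ y := by
    intro y
    conv_lhs => rw [← Finset.univ_sum_single y]
    simp only [map_sum, dotProduct]
    refine Finset.sum_congr rfl fun e _ => ?_
    rw [show Pi.single e (y e) = y e • Pi.single e (1 : ZMod 2) by simp [← Pi.single_smul],
      map_smul, smul_eq_mul, mul_comm]
  refine hfz ((hfc z).trans (hz _ ?_))
  ext v
  have := hf ⟨Pi.single v 1, rfl⟩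
  rw [LinearMap.mem_ker, hfc] at this
  rw [mulVecLin_apply, dotProduct_mulVec] at this
  simpa using this

end Graph

theorem vecMul_portMatrix {Q V : Type} [DecidableEq Q] [Fintype V] [DecidableEq V]
    (L : Finset Q) (f : Q → V)
    (β : V → ZMod 2) : β ᵥ* portMatrix L f = fun q => if q ∈ L then β (f q) else 0 := by
  ext q
  by_cases h : q ∈ L <;> simp [vecMul, dotProduct, portMatrix, h]

/-! ### Stabilizers, logical operators and dimension of the deformed code -/

namespace JointSurgery

variable {Q S : Type} [Fintype Q] [DecidableEq Q] [Fintype S]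
  {C : StabilizerCode Q S} {Ll Lr : Finset Q} (A : JointSurgery C Ll Lr)

/-- The ports as a matrix: vertices are rows, qubits are columns. -/
abbrev ports : Matrix A.V Q (ZMod 2) := portMatrix Ll A.portL + portMatrix Lr A.portR

theorem sum_ports_mulVec (P : Pauli Q) :
    ∑ v, (A.ports *ᵥ P.1) v = symp P (zOn Ll + zOn Lr) := by
  have h : ∑ v, (A.ports *ᵥ P.1) v = (fun _ => (1 : ZMod 2)) ⬝ᵥ (A.ports *ᵥ P.1) := by
    simp [dotProduct]
  rw [h, dotProduct_mulVec, vecMul_add, vecMul_portMatrix, vecMul_portMatrix]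
  simp only [dotProduct, symp, zOn, Prod.fst_add, Prod.snd_add, Pi.add_apply, add_zero,
    Pi.zero_apply, mul_zero]
  exact Finset.sum_congr rfl fun q _ => mul_comm _ _

theorem withEdges_add (P R : Pauli Q) (c d : A.graph.edgeSet → ZMod 2) :
    A.withEdges (P + R) (c + d) = A.withEdges P c + A.withEdges R d := by
  ext (q | e) <;> simp [withEdges]

/-- `withEdges` as a linear map. -/
def withEdgesLin : (Pauli Q × (A.graph.edgeSet → ZMod 2)) →ₗ[ZMod 2]
    Pauli (Q ⊕ A.graph.edgeSet) where
  toFun p := A.withEdges p.1 p.2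
  map_add' p r := A.withEdges_add _ _ _ _
  map_smul' a p := by ext (q | e) <;> simp [withEdges]

theorem withEdges_injective {P R : Pauli Q} {c d : A.graph.edgeSet → ZMod 2}
    (h : A.withEdges P c = A.withEdges R d) : P = R ∧ c = d := by
  have h1 := congrArg Prod.fst h
  have h2 := congrArg Prod.snd h
  refine ⟨Prod.ext ?_ ?_, ?_⟩
  · ext q; exact congrFun h1 (Sum.inl q)
  · ext q; exact congrFun h2 (Sum.inl q)
  · ext e; exact congrFun h1 (Sum.inr e)

theorem symp_withEdges (P R : Pauli Q) (c d : A.graph.edgeSet → ZMod 2) :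
    symp (A.withEdges P c) (A.withEdges R d) = symp P R := by
  simp [symp, withEdges]

theorem symp_withEdges_vertexCheck (P : Pauli Q) (c : A.graph.edgeSet → ZMod 2) (v : A.V) :
    symp (A.withEdges P c) (A.vertexCheck v) =
      (A.ports *ᵥ P.1) v + (c ᵥ* incidence A.graph) v := by
  simp [symp, withEdges, vertexCheck, mulVec, vecMul, dotProduct, mul_comm]

theorem isLogical_withEdges_iff (P : Pauli Q) (c : A.graph.edgeSet → ZMod 2) :
    A.deformed.IsLogical (A.withEdges P c) ↔
      C.IsLogical P ∧ c ᵥ* incidence A.graph = A.ports *ᵥ P.1 := by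
  constructor
  · intro h
    refine ⟨fun s => ?_, funext fun v => ?_⟩
    · rw [← A.symp_withEdges P (C.check s) c (A.matching s)]
      exact h (Sum.inl s)
    · have := h (Sum.inr (Sum.inl v))
      rw [show A.deformed.check (Sum.inr (Sum.inl v)) = A.vertexCheck v from rfl,
        symp_withEdges_vertexCheck, zmod2_add_eq_zero_iff] at this
      exact this.symm
  · rintro ⟨h1, h2⟩ (s | v | u)
    · exact (A.symp_withEdges _ _ _ _).trans (h1 s)
    · refine (A.symp_withEdges_vertexCheck _ _ _).trans ?_
      rw [h2]
      exact add_self_eq_zero_of_zmod2 _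
    · refine (A.symp_withEdges _ _ _ _).trans ?_
      simp [symp]

/-- Sums of vertex checks. -/
def vertexSum (β : A.V → ZMod 2) : Pauli (Q ⊕ A.graph.edgeSet) :=
  (0, Sum.elim (β ᵥ* A.ports) (incidence A.graph *ᵥ β))

theorem sum_smul_vertexCheck (β : A.V → ZMod 2) :
    ∑ v, β v • A.vertexCheck v = A.vertexSum β := by
  ext (q | e)
  · simp [vertexCheck, vertexSum, Prod.fst_sum]
  · simp [vertexCheck, vertexSum, Prod.fst_sum]
  · simp [vertexCheck, vertexSum, Prod.snd_sum, vecMul, dotProduct]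
  · simp [vertexCheck, vertexSum, Prod.snd_sum, mulVec, dotProduct, mul_comm]

theorem check_mem (i : S ⊕ A.V ⊕ A.U) : A.deformedCheck i ∈ A.deformed.stabilizer :=
  Submodule.subset_span ⟨i, rfl⟩

theorem vertexSum_mem (β : A.V → ZMod 2) : A.vertexSum β ∈ A.deformed.stabilizer := by
  rw [← sum_smul_vertexCheck]
  exact Submodule.sum_mem _ fun v _ => Submodule.smul_mem _ _ (A.check_mem (Sum.inr (Sum.inl v)))

/-- Every edge has two ends, so the edge operators cancel in the product of all vertex checks. -/
theorem vertexSum_const (b : ZMod 2) :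
    A.vertexSum (fun _ => b) = A.withEdges (b • (zOn Ll + zOn Lr)) 0 := by
  have h : incidence A.graph *ᵥ (fun _ => b) = 0 := by
    ext ⟨e, he⟩
    induction e with | _ u v
    rw [incidence_mulVec _ he]
    exact add_self_eq_zero_of_zmod2 b
  rw [vertexSum, h, vecMul_add, vecMul_portMatrix, vecMul_portMatrix]
  ext (q | e) <;> simp [withEdges, zOn]

theorem product_mem : A.withEdges (zOn Ll + zOn Lr) 0 ∈ A.deformed.stabilizer := by
  have := A.vertexSum_const 1
  rw [one_smul] at this
  rw [← this]
  exact A.vertexSum_mem _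

theorem withEdges_zero_cycle_mem {c : A.graph.edgeSet → ZMod 2}
    (hc : c ᵥ* incidence A.graph = 0) : A.withEdges 0 c ∈ A.deformed.stabilizer := by
  rw [← A.cycle_span] at hc
  have hle : Submodule.span (ZMod 2) (Set.range A.cycle) ≤
      A.deformed.stabilizer.comap (A.withEdgesLin ∘ₗ LinearMap.inr (ZMod 2) _ _) := by
    rw [Submodule.span_le]
    rintro _ ⟨u, rfl⟩
    exact A.check_mem (Sum.inr (Sum.inr u))
  exact hle hc

theorem exists_withEdges_mem {P : Pauli Q}
    (hP : P ∈ C.stabilizer ⊔ Submodule.span (ZMod 2) {zOn Ll + zOn Lr}) :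
    ∃ c, A.withEdges P c ∈ A.deformed.stabilizer := by
  obtain ⟨R, hR, T, hT, rfl⟩ := Submodule.mem_sup.1 hP
  have hle : C.stabilizer ≤
      (A.deformed.stabilizer.comap A.withEdgesLin).map (LinearMap.fst (ZMod 2) _ _) := by
    rw [StabilizerCode.stabilizer, Submodule.span_le]
    rintro _ ⟨s, rfl⟩
    exact ⟨(C.check s, A.matching s), A.check_mem (Sum.inl s), rfl⟩
  obtain ⟨⟨R, c⟩, hc, rfl⟩ := hle hR
  obtain ⟨b, rfl⟩ := Submodule.mem_span_singleton.1 hT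
  refine ⟨c + 0, ?_⟩
  rw [withEdges_add]
  refine Submodule.add_mem _ hc ?_
  rw [← vertexSum_const]
  exact A.vertexSum_mem _

/-- Each stabilizer of the deformed code is a deformed stabilizer times a product of vertex
checks. -/
theorem exists_of_mem_stabilizer {P' : Pauli (Q ⊕ A.graph.edgeSet)}
    (h : P' ∈ A.deformed.stabilizer) :
    ∃ R ∈ C.stabilizer, ∃ c β, P' = A.withEdges R c + A.vertexSum β := by
  obtain ⟨k, rfl⟩ := (Submodule.mem_span_range_iff_exists_fun _).1 h
  refine ⟨∑ s, k (Sum.inl s) • C.check s, Submodule.sum_mem _ fun s _ =>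
    Submodule.smul_mem _ _ (Submodule.subset_span ⟨s, rfl⟩),
    ∑ s, k (Sum.inl s) • A.matching s + ∑ u, k (Sum.inr (Sum.inr u)) • A.cycle u,
    fun v => k (Sum.inr (Sum.inl v)), ?_⟩
  rw [← add_zero (∑ s, k (Sum.inl s) • C.check s), withEdges_add]
  have h1 : A.withEdges (∑ s, k (Sum.inl s) • C.check s) (∑ s, k (Sum.inl s) • A.matching s) =
      ∑ s, k (Sum.inl s) • A.withEdges (C.check s) (A.matching s) := by
    have := map_sum A.withEdgesLin (fun s => k (Sum.inl s) • (C.check s, A.matching s)) Finset.univ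
    simp only [map_smul] at this
    refine Eq.trans ?_ this
    change _ = A.withEdges _ _
    simp [Prod.fst_sum, Prod.snd_sum]
  have h2 : A.withEdges 0 (∑ u, k (Sum.inr (Sum.inr u)) • A.cycle u) =
      ∑ u, k (Sum.inr (Sum.inr u)) • A.withEdges 0 (A.cycle u) := by
    have := map_sum A.withEdgesLin
      (fun u => k (Sum.inr (Sum.inr u)) • ((0 : Pauli Q), A.cycle u)) Finset.univ
    simp only [map_smul] at this
    refine Eq.trans ?_ this
    change _ = A.withEdges _ _
    simp [Prod.fst_sum, Prod.snd_sum]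
  rw [h1, h2, ← sum_smul_vertexCheck]
  simp only [Fintype.sum_sum_type]
  change (∑ s, k (Sum.inl s) • A.withEdges (C.check s) (A.matching s)) +
    ((∑ v, k (Sum.inr (Sum.inl v)) • A.vertexCheck v) +
      ∑ u, k (Sum.inr (Sum.inr u)) • A.withEdges 0 (A.cycle u)) = _
  abel

/-- No `Z` on the edges means that the vertex checks used form a trivial cut. By connectedness
either none or all of them occur, and all of them multiply to the measured product. -/
theorem mem_sup_of_withEdges_mem {P : Pauli Q} {c : A.graph.edgeSet → ZMod 2}
    (h : A.withEdges P c ∈ A.deformed.stabilizer) :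
    P ∈ C.stabilizer ⊔ Submodule.span (ZMod 2) {zOn Ll + zOn Lr} := by
  obtain ⟨R, hR, d, β, hd⟩ := A.exists_of_mem_stabilizer h
  have hβ : incidence A.graph *ᵥ β = 0 := by
    ext e
    simpa [withEdges, vertexSum] using (congrFun (congrArg Prod.snd hd) (Sum.inr e)).symm
  obtain ⟨r⟩ := A.connected.nonempty
  have hconst : β = fun _ => β r :=
    funext fun v => eq_of_incidence_mulVec_eq_zero A.connected hβ v r
  rw [hconst, vertexSum_const, ← withEdges_add] at hd
  rw [(A.withEdges_injective hd).1]
  exact Submodule.add_mem_sup hR (Submodule.smul_mem _ _ (Submodule.mem_span_singleton_self _))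

/-- Commuting with the product is evenness of the set of ports that `P` excites, which is what makes
this set a boundary. -/
theorem exists_isLogical_withEdges {P : Pauli Q} (hP : C.IsLogical P)
    (hcomm : symp P (zOn Ll + zOn Lr) = 0) : ∃ c, A.deformed.IsLogical (A.withEdges P c) := by
  obtain ⟨c, hc⟩ := exists_boundary A.connected ((A.sum_ports_mulVec P).trans hcomm)
  exact ⟨c, (A.isLogical_withEdges_iff P c).2 ⟨hP, hc⟩⟩

theorem symp_eq_zero_of_mem_stabilizer {R T : Type} [Fintype R] [Fintype T]
    (C : StabilizerCode R T) {P P' : Pauli R} (hP : C.IsLogical P) (hP' : P' ∈ C.stabilizer) :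
    symp P P' = 0 := by
  have hle : C.stabilizer ≤ LinearMap.ker (sympForm R P) := by
    rw [StabilizerCode.stabilizer, Submodule.span_le]
    rintro _ ⟨s, rfl⟩
    exact hP s
  exact hle hP'

theorem isLogical_of_mem_stabilizer {R T : Type} [Fintype R] [Fintype T]
    (C : StabilizerCode R T) {P : Pauli R} (hP : P ∈ C.stabilizer) : C.IsLogical P := fun s => by
  rw [symp_swap]
  exact symp_eq_zero_of_mem_stabilizer C (fun t => C.comm s t) hP

theorem isLogical_add {R T : Type} [Fintype R] [Fintype T]
    {C : StabilizerCode R T} {P P' : Pauli R} (hP : C.IsLogical P) (hP' : C.IsLogical P') :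
    C.IsLogical (P + P') := fun s => by rw [symp_add_left, hP s, hP' s, add_zero]

/-- The cycle space of the auxiliary graph. -/
abbrev cycleSpace : Submodule (ZMod 2) (A.graph.edgeSet → ZMod 2) :=
  LinearMap.ker (incidence A.graph).vecMulLinear

/-- The cut space of the auxiliary graph. -/
abbrev cutSpace : Submodule (ZMod 2) (A.graph.edgeSet → ZMod 2) :=
  LinearMap.range (incidence A.graph).mulVecLin

theorem finrank_cycleSpace_add_finrank_cutSpace :
    Module.finrank (ZMod 2) A.cycleSpace + Module.finrank (ZMod 2) A.cutSpace =
      Fintype.card A.graph.edgeSet := by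
  have h := LinearMap.finrank_range_add_finrank_ker (incidence A.graph).vecMulLinear
  have h2 := Matrix.rank_transpose (incidence A.graph)
  rw [Matrix.rank, Matrix.rank, Matrix.mulVecLin_transpose] at h2
  rw [h2, Module.finrank_pi] at h
  rw [add_comm]
  exact h

/-- The `Z`-type restriction of a Pauli operator to the edge qubits. -/
def edgeZ : Pauli (Q ⊕ A.graph.edgeSet) →ₗ[ZMod 2] (A.graph.edgeSet → ZMod 2) where
  toFun P e := P.2 (Sum.inr e)
  map_add' _ _ := rfl
  map_smul' _ _ := rfl

theorem edgeZ_vertexSum (β : A.V → ZMod 2) :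
    A.edgeZ (A.vertexSum β) = incidence A.graph *ᵥ β := rfl

theorem eq_withEdges_of_edgeZ {P : Pauli (Q ⊕ A.graph.edgeSet)} (h : A.edgeZ P = 0) :
    P = A.withEdges (leftPart P) (fun e => P.1 (Sum.inr e)) := by
  ext (q | e)
  · rfl
  · rfl
  · rfl
  · exact congrFun h e

theorem map_edgeZ_stabilizer : A.deformed.stabilizer.map A.edgeZ = A.cutSpace := by
  ext z
  constructor
  · rintro ⟨P, hP, rfl⟩
    obtain ⟨R, hR, d, β, rfl⟩ := A.exists_of_mem_stabilizer hP
    refine ⟨β, ?_⟩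
    rw [map_add, edgeZ_vertexSum]
    ext e
    simp [edgeZ, withEdges]
  · rintro ⟨β, rfl⟩
    exact ⟨_, A.vertexSum_mem β, rfl⟩

theorem finrank_map_of_injective {M N : Type*} [AddCommGroup M] [Module (ZMod 2) M]
    [AddCommGroup N] [Module (ZMod 2) N] {f : M →ₗ[ZMod 2] N} (hf : Function.Injective f)
    (W : Submodule (ZMod 2) M) :
    Module.finrank (ZMod 2) (W.map f) = Module.finrank (ZMod 2) W :=
  (Submodule.equivMapOfInjective f hf W).finrank_eq.symm

theorem finrank_map_add_finrank_inf_ker {M N : Type*} [AddCommGroup M] [Module (ZMod 2) M]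
    [AddCommGroup N] [Module (ZMod 2) N] [FiniteDimensional (ZMod 2) M]
    (f : M →ₗ[ZMod 2] N) (W : Submodule (ZMod 2) M) :
    Module.finrank (ZMod 2) (W.map f) + Module.finrank (ZMod 2) (W ⊓ LinearMap.ker f : Submodule _ M)
      = Module.finrank (ZMod 2) W := by
  have h := LinearMap.finrank_range_add_finrank_ker (f.domRestrict W)
  rw [LinearMap.range_domRestrict, LinearMap.ker_domRestrict] at h
  rw [← h]
  congr 1
  rw [← Submodule.map_comap_subtype, finrank_map_of_injective W.subtype_injective]

/-- The stabilizer is filtered by two projections. Its edge `Z`-parts form the cut space; the kernel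
projects onto the original checks together with the product; what remains is the cycle space as `X`
operators. Cuts and cycles together contribute one dimension per edge. -/
theorem finrank_deformed_stabilizer :
    Module.finrank (ZMod 2) A.deformed.stabilizer =
      Module.finrank (ZMod 2)
        (C.stabilizer ⊔ Submodule.span (ZMod 2) {zOn Ll + zOn Lr} : Submodule _ (Pauli Q)) +
      Fintype.card A.graph.edgeSet := by
  have h1 := finrank_map_add_finrank_inf_ker A.edgeZ A.deformed.stabilizer
  have h2 := finrank_map_add_finrank_inf_ker leftPart
    (A.deformed.stabilizer ⊓ LinearMap.ker A.edgeZ)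
  rw [A.map_edgeZ_stabilizer] at h1
  have h3 : (A.deformed.stabilizer ⊓ LinearMap.ker A.edgeZ).map leftPart =
      C.stabilizer ⊔ Submodule.span (ZMod 2) {zOn Ll + zOn Lr} := by
    ext P
    constructor
    · rintro ⟨P', ⟨hP', hz⟩, rfl⟩
      rw [A.eq_withEdges_of_edgeZ hz] at hP'
      exact A.mem_sup_of_withEdges_mem hP'
    · intro hP
      obtain ⟨c, hc⟩ := A.exists_withEdges_mem hP
      exact ⟨_, ⟨hc, rfl⟩, rfl⟩
  have h4 : A.deformed.stabilizer ⊓ LinearMap.ker A.edgeZ ⊓ LinearMap.ker leftPart =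
      A.cycleSpace.map (A.withEdgesLin ∘ₗ LinearMap.inr (ZMod 2) _ _) := by
    ext P
    constructor
    · rintro ⟨⟨hP, hz⟩, hP0⟩
      have he := A.eq_withEdges_of_edgeZ hz
      rw [LinearMap.mem_ker.1 hP0] at he
      refine ⟨_, ?_, he.symm⟩
      have hlog := isLogical_of_mem_stabilizer _ hP
      rw [he, isLogical_withEdges_iff] at hlog
      simpa using hlog.2
    · rintro ⟨c, hc, rfl⟩
      exact ⟨⟨A.withEdges_zero_cycle_mem hc, rfl⟩, rfl⟩
  have h5 : Function.Injective (A.withEdgesLin ∘ₗ LinearMap.inr (ZMod 2) _ _) :=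
    fun c d h => (A.withEdges_injective h).2
  rw [h3, h4, finrank_map_of_injective h5] at h2
  have h6 := A.finrank_cycleSpace_add_finrank_cutSpace
  omega

theorem finrank_sup_span_singleton {M : Type*} [AddCommGroup M] [Module (ZMod 2) M]
    [FiniteDimensional (ZMod 2) M] (W : Submodule (ZMod 2) M) {x : M} (hx : x ∉ W) :
    Module.finrank (ZMod 2) (W ⊔ Submodule.span (ZMod 2) {x} : Submodule _ M) =
      Module.finrank (ZMod 2) W + 1 := by
  have h := Submodule.finrank_sup_add_finrank_inf_eq W (Submodule.span (ZMod 2) {x})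
  have hinf : W ⊓ Submodule.span (ZMod 2) {x} = ⊥ := by
    rw [Submodule.eq_bot_iff]
    rintro y ⟨hy, hy'⟩
    obtain ⟨b, rfl⟩ := Submodule.mem_span_singleton.1 hy'
    by_contra hb
    have : b = 1 := zmod2_eq_one_of_ne_zero fun h0 => hb (by rw [h0, zero_smul])
    rw [this, one_smul] at hy
    exact hx hy
  have hx0 : x ≠ 0 := fun h0 => hx (h0 ▸ W.zero_mem)
  rw [hinf, finrank_bot, finrank_span_singleton hx0] at h
  exact h

/-- Auxiliary graph surgery measures only the product, whatever the auxiliary graph. -/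
theorem measuresOnlyProduct (hl : C.IsLogical (zOn Ll)) (hr : C.IsLogical (zOn Lr)) :
    A.MeasuresOnlyProduct := by
  refine ⟨A.product_mem, fun P => ⟨fun ⟨c, hc⟩ => A.mem_sup_of_withEdges_mem hc,
    A.exists_withEdges_mem⟩, fun P => A.exists_isLogical_withEdges, fun hne => ?_⟩
  have h1 := A.finrank_deformed_stabilizer
  rw [finrank_sup_span_singleton _ hne] at h1
  have hlog : C.IsLogical (zOn Ll + zOn Lr) := isLogical_add hl hr
  -- `numLogical` is a truncated subtraction; this bound ensures that enlarging the stabilizer by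
  -- one generator really lowers it by one.
  have h2 := finrank_le_card_of_isotropic
    (C.stabilizer ⊔ Submodule.span (ZMod 2) {zOn Ll + zOn Lr}) (by
      have key : ∀ b : ZMod 2, C.IsLogical (b • (zOn Ll + zOn Lr)) := fun b s => by
        have := hlog s
        rw [← sympForm_apply] at this ⊢
        rw [map_smul, LinearMap.smul_apply, this, smul_zero]
      intro P hP R hR
      obtain ⟨P, hP', T, hT, rfl⟩ := Submodule.mem_sup.1 hP
      obtain ⟨R, hR', U, hU, rfl⟩ := Submodule.mem_sup.1 hR
      obtain ⟨b, rfl⟩ := Submodule.mem_span_singleton.1 hT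
      obtain ⟨d, rfl⟩ := Submodule.mem_span_singleton.1 hU
      rw [symp_add_left, symp_add_right, symp_add_right,
        symp_eq_zero_of_mem_stabilizer C (isLogical_of_mem_stabilizer C hP') hR', symp_swap P,
        symp_eq_zero_of_mem_stabilizer C (key d) hP', symp_eq_zero_of_mem_stabilizer C (key b) hR']
      have : symp (b • (zOn Ll + zOn Lr)) (d • (zOn Ll + zOn Lr)) = 0 := by
        rw [← sympForm_apply, map_smul, map_smul, LinearMap.smul_apply, sympForm_apply, symp_self]
        simp
      rw [this]
      simp)
  rw [finrank_sup_span_singleton _ hne] at h2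
  rw [StabilizerCode.numLogical, StabilizerCode.numLogical, h1, Fintype.card_sum]
  omega

end JointSurgery

/-! ### Weights -/

theorem weight_add_le {Q : Type} [Fintype Q] (P R : Pauli Q) :
    weight (P + R) ≤ weight P + weight R := by
  refine (Set.ncard_le_ncard ?_ (Set.toFinite _)).trans (Set.ncard_union_le _ _)
  intro q hq
  simp only [support, Set.mem_union, Set.mem_ofPred_eq, Prod.fst_add, Prod.snd_add,
    Pi.add_apply] at hq ⊢
  by_contra! h
  simp [h.1.1, h.1.2, h.2.1, h.2.2] at hq

theorem weight_zOn {Q : Type} [DecidableEq Q] (L : Finset Q) : weight (zOn L) = L.card := by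
  rw [weight, ← Set.ncard_coe_finset]
  congr 1
  ext q
  simp [support, zOn]

theorem weight_eq_leftPart_add_rightPart {Q₁ Q₂ : Type} [Fintype Q₁] [Fintype Q₂]
    (P : Pauli (Q₁ ⊕ Q₂)) : weight P = weight (leftPart P) + weight (rightPart P) := by
  have h : support P = Sum.inl '' support (leftPart P) ∪ Sum.inr '' support (rightPart P) := by
    ext (q | q) <;> simp [support, leftPart, rightPart]
  rw [weight, h, Set.ncard_union_eq ?_ (Set.toFinite _) (Set.toFinite _),
    Set.ncard_image_of_injective _ Sum.inl_injective,
    Set.ncard_image_of_injective _ Sum.inr_injective]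
  · rfl
  · rw [Set.disjoint_left]
    rintro _ ⟨q, _, rfl⟩ ⟨q', _, h'⟩
    cases h'

theorem zOn_filter_add {Q : Type} [DecidableEq Q] (L : Finset Q) (p : Q → Prop)
    [DecidablePred p] : zOn (L.filter p) + zOn L = zOn (L.filter fun q => ¬ p q) := by
  ext q
  · simp [zOn]
  · by_cases h1 : q ∈ L <;> by_cases h2 : p q <;>
      simp [zOn, h1, h2, add_self_eq_zero_of_zmod2]

/-! ### Separate codeblocks -/

section Blocks

variable {Q₁ S₁ Q₂ S₂ : Type}

/-- An operator on the first block, as an operator on both blocks. -/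
def inLeft : Pauli Q₁ →ₗ[ZMod 2] Pauli (Q₁ ⊕ Q₂) where
  toFun P := (Sum.elim P.1 0, Sum.elim P.2 0)
  map_add' _ _ := by ext (q | q) <;> simp
  map_smul' _ _ := by ext (q | q) <;> simp

/-- An operator on the second block, as an operator on both blocks. -/
def inRight : Pauli Q₂ →ₗ[ZMod 2] Pauli (Q₁ ⊕ Q₂) where
  toFun P := (Sum.elim 0 P.1, Sum.elim 0 P.2)
  map_add' _ _ := by ext (q | q) <;> simp
  map_smul' _ _ := by ext (q | q) <;> simp

theorem inLeft_add_inRight (P : Pauli (Q₁ ⊕ Q₂)) :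
    inLeft (leftPart P) + inRight (rightPart P) = P := by
  ext (q | q) <;> simp [inLeft, inRight, leftPart, rightPart]

theorem leftPart_zOn_inl [DecidableEq Q₁] [DecidableEq Q₂] (L : Finset Q₁) :
    leftPart (zOn (L.map (Function.Embedding.inl (β := Q₂)))) = zOn L := by
  ext q <;> simp [leftPart, zOn]

theorem rightPart_zOn_inl [DecidableEq Q₁] [DecidableEq Q₂] (L : Finset Q₁) :
    rightPart (zOn (L.map (Function.Embedding.inl (β := Q₂)))) = 0 := by
  ext q <;> simp [rightPart, zOn]

theorem leftPart_zOn_inr [DecidableEq Q₁] [DecidableEq Q₂] (L : Finset Q₂) :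
    leftPart (zOn (L.map (Function.Embedding.inr (α := Q₁)))) = 0 := by
  ext q <;> simp [leftPart, zOn]

theorem rightPart_zOn_inr [DecidableEq Q₁] [DecidableEq Q₂] (L : Finset Q₂) :
    rightPart (zOn (L.map (Function.Embedding.inr (α := Q₁)))) = zOn L := by
  ext q <;> simp [rightPart, zOn]

variable [Fintype Q₁] [Fintype S₁] [Fintype Q₂] [Fintype S₂]
  (C₁ : StabilizerCode Q₁ S₁) (C₂ : StabilizerCode Q₂ S₂)

theorem isLogical_sum_iff (P : Pauli (Q₁ ⊕ Q₂)) :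
    (C₁.sum C₂).IsLogical P ↔ C₁.IsLogical (leftPart P) ∧ C₂.IsLogical (rightPart P) := by
  have h1 : ∀ s, symp P ((C₁.sum C₂).check (Sum.inl s)) = symp (leftPart P) (C₁.check s) :=
    fun s => by simp [symp, StabilizerCode.sum, leftPart]
  have h2 : ∀ s, symp P ((C₁.sum C₂).check (Sum.inr s)) = symp (rightPart P) (C₂.check s) :=
    fun s => by simp [symp, StabilizerCode.sum, rightPart]
  simp only [StabilizerCode.IsLogical, Sum.forall, h1, h2]

theorem mem_stabilizer_sum_iff (P : Pauli (Q₁ ⊕ Q₂)) :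
    P ∈ (C₁.sum C₂).stabilizer ↔
      leftPart P ∈ C₁.stabilizer ∧ rightPart P ∈ C₂.stabilizer := by
  constructor
  · intro hP
    have hle : (C₁.sum C₂).stabilizer ≤
        C₁.stabilizer.comap leftPart ⊓ C₂.stabilizer.comap rightPart := by
      rw [StabilizerCode.stabilizer, Submodule.span_le]
      rintro _ ⟨s | s, rfl⟩
      · exact ⟨Submodule.subset_span ⟨s, rfl⟩, C₂.stabilizer.zero_mem⟩
      · exact ⟨C₁.stabilizer.zero_mem, Submodule.subset_span ⟨s, rfl⟩⟩
    exact hle hP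
  · rintro ⟨h1, h2⟩
    rw [← inLeft_add_inRight P]
    have hl : C₁.stabilizer ≤ (C₁.sum C₂).stabilizer.comap inLeft := by
      rw [StabilizerCode.stabilizer, Submodule.span_le]
      rintro _ ⟨s, rfl⟩
      exact Submodule.subset_span ⟨Sum.inl s, rfl⟩
    have hr : C₂.stabilizer ≤ (C₁.sum C₂).stabilizer.comap inRight := by
      rw [StabilizerCode.stabilizer, Submodule.span_le]
      rintro _ ⟨s, rfl⟩
      exact Submodule.subset_span ⟨Sum.inr s, rfl⟩
    exact Submodule.add_mem _ (hl h1) (hr h2)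

variable {C₁ C₂}

theorem isLogical_zOn_inl [DecidableEq Q₁] [DecidableEq Q₂] {L : Finset Q₁}
    (h : C₁.IsLogical (zOn L)) :
    (C₁.sum C₂).IsLogical (zOn (L.map Function.Embedding.inl)) := by
  rw [isLogical_sum_iff, leftPart_zOn_inl, rightPart_zOn_inl]
  exact ⟨h, fun s => by simp [symp]⟩

theorem isLogical_zOn_inr [DecidableEq Q₁] [DecidableEq Q₂] {L : Finset Q₂}
    (h : C₂.IsLogical (zOn L)) :
    (C₁.sum C₂).IsLogical (zOn (L.map Function.Embedding.inr)) := by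
  rw [isLogical_sum_iff, leftPart_zOn_inr, rightPart_zOn_inr]
  exact ⟨fun s => by simp [symp], h⟩

theorem isLDPC_sum {a b : ℕ} (h₁ : C₁.IsLDPC a b) (h₂ : C₂.IsLDPC a b) :
    (C₁.sum C₂).IsLDPC a b := by
  have hw : ∀ Q : Type, weight (0 : Pauli Q) = 0 := fun Q => by simp [weight, support]
  constructor
  · rintro (s | s) <;> rw [weight_eq_leftPart_add_rightPart]
    · exact le_of_eq_of_le (congrArg _ (hw Q₂)) (h₁.1 s)
    · exact le_of_eq_of_le ((congrArg (· + _) (hw Q₁)).trans (zero_add _)) (h₂.1 s)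
  · rintro (q | q)
    · refine le_of_eq_of_le ?_ (h₁.2 q)
      rw [← Set.ncard_image_of_injective _ (Sum.inl_injective (α := S₁) (β := S₂))]
      congr 1
      ext (s | s) <;> simp [support, StabilizerCode.sum]
    · refine le_of_eq_of_le ?_ (h₂.2 q)
      rw [← Set.ncard_image_of_injective _ (Sum.inr_injective (α := S₁) (β := S₂))]
      congr 1
      ext (s | s) <;> simp [support, StabilizerCode.sum]

end Blocks

theorem distance_le_weight_add_card {Q S : Type} [Fintype Q] [DecidableEq Q] [Fintype S]
    {C : StabilizerCode Q S} {R : Pauli Q} {L : Finset Q}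
    (h : C.IsNontrivialLogical (R + zOn L)) : C.distance ≤ weight R + L.card := by
  rw [← weight_zOn L]
  have hle : C.distance ≤ weight (R + zOn L) := Nat.sInf_le ⟨_, h, rfl⟩
  exact hle.trans (weight_add_le _ _)

/-! ### Distance of the deformed code -/

namespace JointSurgery

section General

variable {Q S : Type} [Fintype Q] [DecidableEq Q] [Fintype S]
  {C : StabilizerCode Q S} {Ll Lr : Finset Q} (A : JointSurgery C Ll Lr)

/-- Multiplication by vertex checks moves a nontrivial logical operator of the deformed code to a
logical operator of the original code which is not a product of checks and the measured
operator. -/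
theorem exists_cleaned {P : Pauli (Q ⊕ A.graph.edgeSet)} (hP : A.deformed.IsNontrivialLogical P) :
    ∃ β : A.V → ZMod 2, C.IsLogical (leftPart P + (0, β ᵥ* A.ports)) ∧
      leftPart P + (0, β ᵥ* A.ports) ∉
        C.stabilizer ⊔ Submodule.span (ZMod 2) {zOn Ll + zOn Lr} := by
  obtain ⟨β, hβ⟩ := exists_cut (A.edgeZ P) fun c hc => by
    have h := symp_eq_zero_of_mem_stabilizer _ hP.1 (A.withEdges_zero_cycle_mem hc)
    simpa [symp, withEdges, dotProduct, edgeZ, mul_comm] using h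
  have hz : A.edgeZ (P + A.vertexSum β) = 0 := by
    rw [map_add, edgeZ_vertexSum, hβ, add_self_eq_zero_of_zmod2]
  have hlog : A.deformed.IsLogical (P + A.vertexSum β) :=
    isLogical_add hP.1 (isLogical_of_mem_stabilizer _ (A.vertexSum_mem β))
  have heq := A.eq_withEdges_of_edgeZ hz
  set c : A.graph.edgeSet → ZMod 2 := fun e => (P + A.vertexSum β).1 (Sum.inr e)
  have hleft : leftPart (P + A.vertexSum β) = leftPart P + (0, β ᵥ* A.ports) := by
    rw [map_add]; rfl
  rw [hleft] at heq
  rw [heq, isLogical_withEdges_iff] at hlog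
  refine ⟨β, hlog.1, fun hmem => hP.2 ?_⟩
  -- A stabilizer with the same part on the original qubits has an edge part `d` with the same
  -- boundary as `c`. The two differ by a cycle, so the cleaned operator, and hence `P`, would be a
  -- stabilizer.
  obtain ⟨d, hd⟩ := A.exists_withEdges_mem hmem
  have hd2 := ((A.isLogical_withEdges_iff _ _).1 (isLogical_of_mem_stabilizer _ hd)).2
  have hcyc : A.withEdges 0 (d + c) ∈ A.deformed.stabilizer := by
    apply A.withEdges_zero_cycle_mem
    rw [add_vecMul, hd2, hlog.2, add_self_eq_zero_of_zmod2]
  have hadd := Submodule.add_mem _ hd hcyc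
  rw [← withEdges_add, add_zero, ← add_assoc, add_self_eq_zero_of_zmod2, zero_add, ← heq] at hadd
  have := Submodule.add_mem _ hadd (A.vertexSum_mem β)
  rwa [add_assoc, add_self_eq_zero_of_zmod2, add_zero] at this

end General

section Separate

variable {Ql Sl Qr Sr : Type} [Fintype Ql] [DecidableEq Ql] [Fintype Sl]
  [Fintype Qr] [DecidableEq Qr] [Fintype Sr]
  {Cl : StabilizerCode Ql Sl} {Cr : StabilizerCode Qr Sr} {Ll : Finset Ql} {Lr : Finset Qr}
  (A : JointSurgery (Cl.sum Cr) (Ll.map Function.Embedding.inl) (Lr.map Function.Embedding.inr))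

/-- A lower bound on the distance needs this, as the infimum of the empty set is `0`. The left
measured operator alone is a witness: being nontrivial in its own block and not accompanied by the
right one, it is not a stabilizer. -/
theorem exists_isNontrivialLogical (hl : Cl.IsNontrivialLogical (zOn Ll))
    (hr : Cr.IsNontrivialLogical (zOn Lr)) : ∃ P, A.deformed.IsNontrivialLogical P := by
  refine ⟨A.withEdges (zOn (Ll.map Function.Embedding.inl)) 0,
    (A.isLogical_withEdges_iff _ _).2 ⟨isLogical_zOn_inl hl.1, ?_⟩, fun h => ?_⟩
  · simp [zOn]
  obtain ⟨R, hR, T, hT, h2⟩ := Submodule.mem_sup.1 (A.mem_sup_of_withEdges_mem h)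
  obtain ⟨b, rfl⟩ := Submodule.mem_span_singleton.1 hT
  rw [mem_stabilizer_sum_iff] at hR
  have hL := congrArg leftPart h2
  have hR2 := congrArg rightPart h2
  simp only [map_add, map_smul, leftPart_zOn_inl, leftPart_zOn_inr, rightPart_zOn_inl,
    rightPart_zOn_inr, add_zero, zero_add] at hL hR2
  by_cases hb : b = 0
  · rw [hb, zero_smul, add_zero] at hL
    exact hl.2 (hL ▸ hR.1)
  · rw [zmod2_eq_one_of_ne_zero hb, one_smul, ← neg_eq_iff_add_eq_zero] at hR2
    exact hr.2 (hR2 ▸ Submodule.neg_mem _ hR.2)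

/-- After cleaning, one block is multiplied by its measured operator, so that one block pays for the
ports inside the cut and the other for those outside. As ports are injective in each block, the
total payment is at most `|B|`, even where the two port sets overlap. -/
theorem distance_add_distance_le_weight (hl : Cl.IsNontrivialLogical (zOn Ll))
    (hr : Cr.IsNontrivialLogical (zOn Lr)) {B : Finset A.V}
    (hBl : ∀ q ∈ Ll, A.portL (Sum.inl q) ∈ B) (hBr : ∀ q ∈ Lr, A.portR (Sum.inr q) ∈ B)
    {P : Pauli ((Ql ⊕ Qr) ⊕ A.graph.edgeSet)} (hP : A.deformed.IsNontrivialLogical P) :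
    Cl.distance + Cr.distance ≤ weight P + B.card := by
  obtain ⟨β, hlog, hnot⟩ := A.exists_cleaned hP
  have hL : leftPart (leftPart P + (0, β ᵥ* A.ports)) =
      leftPart (leftPart P) + zOn (Ll.filter fun q => β (A.portL (Sum.inl q)) ≠ 0) := by
    rw [map_add, vecMul_add, vecMul_portMatrix, vecMul_portMatrix]
    congr 1
    ext q
    · rfl
    · by_cases h : β (A.portL (Sum.inl q)) = 0
      · simp [leftPart, zOn, h]
      · simp [leftPart, zOn, zmod2_eq_one_of_ne_zero h]
  have hR : rightPart (leftPart P + (0, β ᵥ* A.ports)) =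
      rightPart (leftPart P) + zOn (Lr.filter fun q => β (A.portR (Sum.inr q)) ≠ 0) := by
    rw [map_add, vecMul_add, vecMul_portMatrix, vecMul_portMatrix]
    congr 1
    ext q
    · rfl
    · by_cases h : β (A.portR (Sum.inr q)) = 0
      · simp [rightPart, zOn, h]
      · simp [rightPart, zOn, zmod2_eq_one_of_ne_zero h]
  set P' := leftPart P + (0, β ᵥ* A.ports)
  rw [isLogical_sum_iff] at hlog
  have hw1 := weight_eq_leftPart_add_rightPart P
  have hw2 := weight_eq_leftPart_add_rightPart (leftPart P)
  have injL : ∀ q ∈ Ll, ∀ q' ∈ Ll, A.portL (Sum.inl q) = A.portL (Sum.inl q') → q = q' :=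
    fun q hq q' hq' h =>
      Sum.inl_injective (A.portL_inj (by simpa using hq) (by simpa using hq') h)
  have injR : ∀ q ∈ Lr, ∀ q' ∈ Lr, A.portR (Sum.inr q) = A.portR (Sum.inr q') → q = q' :=
    fun q hq q' hq' h =>
      Sum.inr_injective (A.portR_inj (by simpa using hq) (by simpa using hq') h)
  have cardL : ∀ (p : A.V → Prop) [DecidablePred p],
      (Ll.filter fun q => p (A.portL (Sum.inl q))).card ≤ (B.filter p).card := by
    intro p _
    refine Finset.card_le_card_of_injOn (fun q => A.portL (Sum.inl q)) (fun q hq => ?_)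
      fun q hq q' hq' h => ?_
    · simp only [Finset.coe_filter, Set.mem_ofPred_eq] at hq ⊢
      exact ⟨hBl q hq.1, hq.2⟩
    · simp only [Finset.coe_filter, Set.mem_ofPred_eq] at hq hq'
      exact injL q hq.1 q' hq'.1 h
  have cardR : ∀ (p : A.V → Prop) [DecidablePred p],
      (Lr.filter fun q => p (A.portR (Sum.inr q))).card ≤ (B.filter p).card := by
    intro p _
    refine Finset.card_le_card_of_injOn (fun q => A.portR (Sum.inr q)) (fun q hq => ?_)
      fun q hq q' hq' h => ?_
    · simp only [Finset.coe_filter, Set.mem_ofPred_eq] at hq ⊢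
      exact ⟨hBr q hq.1, hq.2⟩
    · simp only [Finset.coe_filter, Set.mem_ofPred_eq] at hq hq'
      exact injR q hq.1 q' hq'.1 h
  have cardB := Finset.card_filter_add_card_filter_not (s := B) (fun v => β v ≠ 0)
  have hlogL : Cl.IsLogical (leftPart P' + zOn Ll) := isLogical_add hlog.1 hl.1
  have hlogR : Cr.IsLogical (rightPart P' + zOn Lr) := isLogical_add hlog.2 hr.1
  have hnot0 : ¬ (leftPart P' ∈ Cl.stabilizer ∧ rightPart P' ∈ Cr.stabilizer) := by
    rw [← mem_stabilizer_sum_iff]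
    exact fun h => hnot (Submodule.mem_sup_left h)
  have hnot1 : ¬ (leftPart P' + zOn Ll ∈ Cl.stabilizer ∧
      rightPart P' + zOn Lr ∈ Cr.stabilizer) := by
    intro h
    have h2 : P' + (zOn (Ll.map Function.Embedding.inl) + zOn (Lr.map Function.Embedding.inr)) ∈
        (Cl.sum Cr).stabilizer := by
      rw [mem_stabilizer_sum_iff]
      simpa only [map_add, leftPart_zOn_inl, leftPart_zOn_inr, rightPart_zOn_inl,
        rightPart_zOn_inr, add_zero, zero_add] using h
    have h3 := Submodule.add_mem_sup h2 (Submodule.mem_span_singleton_self (R := ZMod 2)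
      (zOn (Ll.map Function.Embedding.inl) + zOn (Lr.map Function.Embedding.inr)))
    rw [add_assoc, add_self_eq_zero_of_zmod2, add_zero] at h3
    exact hnot h3
  have both : ∀ {T : Type} [Fintype T] {U : Type} [Fintype U] (C : StabilizerCode T U)
      (x y : Pauli T), y ∉ C.stabilizer → x ∈ C.stabilizer → x + y ∉ C.stabilizer := by
    intro T _ U _ C x y hy hx hxy
    have := Submodule.add_mem _ hx hxy
    rw [← add_assoc, add_self_eq_zero_of_zmod2, zero_add] at this
    exact hy this
  have bL := both Cl (leftPart P') (zOn Ll) hl.2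
  have bR := both Cr (rightPart P') (zOn Lr) hr.2
  by_cases hcase : leftPart P' ∉ Cl.stabilizer ∧ rightPart P' + zOn Lr ∉ Cr.stabilizer
  · have h1 : Cl.IsNontrivialLogical (leftPart P') := ⟨hlog.1, hcase.1⟩
    have h2 : Cr.IsNontrivialLogical (rightPart P' + zOn Lr) := ⟨hlogR, hcase.2⟩
    rw [hL] at h1
    rw [hR, add_assoc, zOn_filter_add] at h2
    have h1 := distance_le_weight_add_card h1
    have h2 := distance_le_weight_add_card h2
    have h3 := cardL fun v => β v ≠ 0
    have h4 := cardR fun v => ¬ β v ≠ 0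
    omega
  -- In each block at most one of the cleaned part and its product with the measured operator is a
  -- stabilizer. If the first choice fails in either block, `hnot0` or `hnot1` transfers
  -- nontriviality to the other block, so the second choice succeeds in both.
  · have hcase' : leftPart P' + zOn Ll ∉ Cl.stabilizer ∧ rightPart P' ∉ Cr.stabilizer := by
      tauto
    have h1 : Cl.IsNontrivialLogical (leftPart P' + zOn Ll) := ⟨hlogL, hcase'.1⟩
    have h2 : Cr.IsNontrivialLogical (rightPart P') := ⟨hlog.2, hcase'.2⟩
    rw [hR] at h2
    rw [hL, add_assoc, zOn_filter_add] at h1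
    have h1 := distance_le_weight_add_card h1
    have h2 := distance_le_weight_add_card h2
    have h3 := cardL fun v => ¬ β v ≠ 0
    have h4 := cardR fun v => β v ≠ 0
    omega

/-- If all ports lie in a common set of `|B|` vertices, the deformed code has distance at least
`dₗ + dᵣ - |B|`. -/
theorem distance_add_distance_le (hl : Cl.IsNontrivialLogical (zOn Ll))
    (hr : Cr.IsNontrivialLogical (zOn Lr)) {B : Finset A.V}
    (hBl : ∀ q ∈ Ll, A.portL (Sum.inl q) ∈ B) (hBr : ∀ q ∈ Lr, A.portR (Sum.inr q) ∈ B) :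
    Cl.distance + Cr.distance ≤ A.deformed.distance + B.card := by
  obtain ⟨P, hP⟩ := A.exists_isNontrivialLogical hl hr
  obtain ⟨R, hR, hw⟩ := Nat.sInf_mem (s := {w | ∃ P, A.deformed.IsNontrivialLogical P ∧
    weight P = w}) ⟨_, P, hP, rfl⟩
  rw [StabilizerCode.distance.eq_def A.deformed, ← hw]
  exact A.distance_add_distance_le_weight hl hr hBl hBr hR

end Separate

end JointSurgery

/-! ### Rearrangeable routing on the cube -/

section Routing

variable {X : Type} {ρ : X → X} {b : X → Bool}

/-- Given a fixed-point-free involution `ρ` and a permutation `π`, the points have a 2-colouring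
that is balanced on the orbits of `ρ` as well as on those of its conjugate under `π`. -/
theorem exists_balanced_coloring [Fintype X] [DecidableEq X] (hρ : ∀ x, ρ (ρ x) = x)
    (hb : ∀ x, b (ρ x) = !b x) (π : Equiv.Perm X) :
    ∃ χ : X → Bool, (∀ x, χ (ρ x) = !χ x) ∧ ∀ x, χ (π.symm (ρ (π x))) = !χ x := by
  have hfix : ∀ x, ρ x ≠ x := fun x h => by simpa [h] using hb x
  let proj : X → {x // b x = false} := fun y =>
    if h : b y = false then ⟨y, h⟩ else ⟨ρ y, by rw [hb]; simpa using h⟩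
  have hproj : ∀ y, (proj y : X) = y ∨ (proj y : X) = ρ y := fun y => by
    by_cases h : b y = false <;> simp [proj, h]
  have hproj_eq : ∀ y z, proj y = proj z → y = z ∨ y = ρ z := fun y z h => by
    have h' := congrArg Subtype.val h
    rcases hproj y with h1 | h1 <;> rcases hproj z with h2 | h2 <;> rw [h1, h2] at h'
    · exact Or.inl h'
    · exact Or.inr h'
    · exact Or.inr (by rw [← h', hρ])
    · exact Or.inl (by rw [← hρ y, h', hρ])
  have hproj_rho : ∀ y, proj (ρ y) = proj y := fun y => by
    apply Subtype.ext
    by_cases h : b y = false <;> simp [proj, h, hb, hρ]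
  have hproj_coe : ∀ x : {x // b x = false}, proj x = x := fun x => by simp [proj, x.2]
  let t : {x // b x = false} → Finset {x // b x = false} := fun x =>
    {proj (π x), proj (π (ρ x))}
  obtain ⟨f, hf, hft⟩ := (Finset.all_card_le_biUnion_card_iff_exists_injective t).1 fun s => by
    -- Hall's condition by counting points: the two points of each orbit in `s` have distinct images
    -- under `π`, all contained in the two-point orbits of `s.biUnion t`.
    let pt : {x // b x = false} × Bool → X := fun p => π (if p.2 then ρ p.1 else p.1)
    have hcard : (s ×ˢ (Finset.univ : Finset Bool)).card ≤
        (s.biUnion t ×ˢ (Finset.univ : Finset Bool)).card := by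
      refine Finset.card_le_card_of_injOn (fun p => (proj (pt p), b (pt p))) ?_ ?_
      · rintro ⟨x, c⟩ hx
        simp only [Finset.coe_product, Set.mem_prod, Finset.mem_coe, Finset.mem_univ,
          and_true] at hx ⊢
        refine Finset.mem_biUnion.2 ⟨x, hx, ?_⟩
        cases c <;> simp [t, pt]
      · rintro ⟨x, c⟩ - ⟨y, d⟩ - h
        simp only [Prod.mk.injEq] at h
        have hpt : pt (x, c) = pt (y, d) := by
          rcases hproj_eq _ _ h.1 with h1 | h1
          · exact h1
          · have := h.2
            rw [h1, hb] at this
            simp at this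
        have h2 := π.injective hpt
        have hx := x.2
        have hy := y.2
        have hxr := hb x
        have hyr := hb y
        cases c <;> cases d <;> simp only [if_true, Bool.false_eq_true, if_false] at h2
        · rw [Subtype.ext h2]
        · rw [h2] at hx; rw [hx, hy] at hyr; simp at hyr
        · rw [← h2] at hy; rw [hx, hy] at hxr; simp at hxr
        · rw [Subtype.ext ((hρ x).symm.trans ((congrArg ρ h2).trans (hρ y)))]
    rw [Finset.card_product, Finset.card_product] at hcard
    exact Nat.le_of_mul_le_mul_right hcard (by simp)
  have hsurj := (Finite.injective_iff_surjective.1 hf)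
  -- From each orbit the point that `π` sends into the matched orbit is selected. Since `f` is
  -- bijective, each target orbit also receives exactly one selected point, so the selected points
  -- form a colour class.
  let c : {x // b x = false} → X := fun x => if f x = proj (π x) then x else ρ x
  have hc : ∀ x, proj (π (c x)) = f x := fun x => by
    have := hft x
    simp only [t, Finset.mem_insert, Finset.mem_singleton] at this
    by_cases h : f x = proj (π x)
    · simp [c, h]
    · simpa [c, h] using (this.resolve_left h).symm
  have hcx : ∀ x : {x // b x = false}, c x = x ∨ c x = ρ x := fun x => by
    by_cases h : f x = proj (π x) <;> simp [c, h]
  have hprojc : ∀ x, proj (c x) = x := fun x => by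
    rcases hcx x with h | h
    · rw [h, hproj_coe]
    · rw [h, hproj_rho, hproj_coe]
  have hmem : ∀ y, c (proj y) = y ∨ c (proj y) = ρ y := fun y =>
    hproj_eq _ _ (hprojc (proj y))
  refine ⟨fun y => decide (y = c (proj y)), fun y => ?_, fun x => ?_⟩
  · change decide (ρ y = c (proj (ρ y))) = !decide (y = c (proj y))
    rw [hproj_rho]
    rcases hmem y with h | h
    · simp [h, hfix y]
    · simp [h, (hfix y).symm]
  · set x' := π.symm (ρ (π x)) with hx'
    have hπ : π x' = ρ (π x) := by rw [hx']; simp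
    have hne : x' ≠ x := fun h => hfix (π x) (by rw [← hπ, h])
    obtain ⟨p, hp⟩ := hsurj (proj (π x))
    rw [← hc] at hp
    have hcp : c p = x ∨ c p = x' := by
      rcases hproj_eq _ _ hp with h | h
      · exact Or.inl (π.injective h)
      · exact Or.inr (π.injective (h.trans hπ.symm))
    have hboth : ¬ (x = c (proj x) ∧ x' = c (proj x')) := by
      rintro ⟨h1, h2⟩
      have h3 : f (proj x) = f (proj x') := by
        rw [← hc, ← hc, ← h1, ← h2, hπ, hproj_rho]
      exact hne (h2.trans ((congrArg c (hf h3)).symm.trans h1.symm))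
    have hone : x = c (proj x) ∨ x' = c (proj x') := by
      rcases hcp with h | h
      · exact Or.inl (by rw [← h, hprojc])
      · exact Or.inr (by rw [← h, hprojc])
    change decide (x' = c (proj x')) = !decide (x = c (proj x))
    by_cases h1 : x = c (proj x)
    · rw [decide_eq_true h1, decide_eq_false fun h2 => hboth ⟨h1, h2⟩]; rfl
    · rw [decide_eq_false h1, decide_eq_true (hone.resolve_left h1)]; rfl

/-- The involution that moves each point within its orbit under `ρ` so as to turn the colouring
`χ` into `b`. -/
def sortOrbits (ρ : X → X) (b χ : X → Bool) (hρ : ∀ x, ρ (ρ x) = x) (hb : ∀ x, b (ρ x) = !b x)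
    (hχ : ∀ x, χ (ρ x) = !χ x) : Equiv.Perm X :=
  Function.Involutive.toPerm (fun x => if χ x = b x then x else ρ x) fun x => by
    by_cases h : χ x = b x
    · simp [h]
    · have h' : χ (ρ x) ≠ b (ρ x) := by rw [hb, hχ]; simpa using h
      simp [h, h', hρ]

theorem sortOrbits_apply (hρ : ∀ x, ρ (ρ x) = x) (hb : ∀ x, b (ρ x) = !b x) {χ : X → Bool}
    (hχ : ∀ x, χ (ρ x) = !χ x) (x : X) :
    sortOrbits ρ b χ hρ hb hχ x = if χ x = b x then x else ρ x := rfl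

theorem sortOrbits_mem (hρ : ∀ x, ρ (ρ x) = x) (hb : ∀ x, b (ρ x) = !b x) {χ : X → Bool}
    (hχ : ∀ x, χ (ρ x) = !χ x) (x : X) :
    sortOrbits ρ b χ hρ hb hχ x = x ∨ sortOrbits ρ b χ hρ hb hχ x = ρ x := by
  by_cases h : χ x = b x <;> simp [sortOrbits_apply, h]

theorem sortOrbits_sortOrbits (hρ : ∀ x, ρ (ρ x) = x) (hb : ∀ x, b (ρ x) = !b x) {χ : X → Bool}
    (hχ : ∀ x, χ (ρ x) = !χ x) (x : X) :
    sortOrbits ρ b χ hρ hb hχ (sortOrbits ρ b χ hρ hb hχ x) = x :=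
  (sortOrbits ρ b χ hρ hb hχ).left_inv x

theorem apply_sortOrbits (hρ : ∀ x, ρ (ρ x) = x) (hb : ∀ x, b (ρ x) = !b x) {χ : X → Bool}
    (hχ : ∀ x, χ (ρ x) = !χ x) (x : X) : b (sortOrbits ρ b χ hρ hb hχ x) = χ x := by
  by_cases h : χ x = b x
  · simp [sortOrbits_apply, h]
  · rw [sortOrbits_apply, if_neg h, hb]
    revert h
    cases χ x <;> cases b x <;> simp

/-- One stage of a Beneš network: a permutation becomes compatible with `b` after composition on
both sides with involutions that preserve the orbits of `ρ`. -/
theorem exists_benes_stage [Fintype X] [DecidableEq X] (hρ : ∀ x, ρ (ρ x) = x)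
    (hb : ∀ x, b (ρ x) = !b x) (π : Equiv.Perm X) :
    ∃ σ τ π' : Equiv.Perm X, (∀ x, σ (σ x) = x) ∧ (∀ x, σ x = x ∨ σ x = ρ x) ∧
      (∀ x, τ x = x ∨ τ x = ρ x) ∧ (∀ x, π' x = τ (π (σ x))) ∧ ∀ x, b (π' x) = b x := by
  obtain ⟨χ, h1, h2⟩ := exists_balanced_coloring hρ hb π
  have h3 : ∀ y, χ (π.symm (ρ y)) = !χ (π.symm y) := fun y => by
    simpa using h2 (π.symm y)
  refine ⟨sortOrbits ρ b χ hρ hb h1, sortOrbits ρ b (fun y => χ (π.symm y)) hρ hb h3,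
    (sortOrbits ρ b χ hρ hb h1).trans
      (π.trans (sortOrbits ρ b (fun y => χ (π.symm y)) hρ hb h3)),
    sortOrbits_sortOrbits hρ hb h1, sortOrbits_mem hρ hb h1, sortOrbits_mem hρ hb h3,
    fun x => rfl, fun x => ?_⟩
  -- The outer involution turns the colour transported by `π` into `b`, so the image of `x` has bit
  -- `χ (σ x)`; this is `b (σ (σ x)) = b x`.
  refine (apply_sortOrbits (χ := fun y => χ (π.symm y)) hρ hb h3 _).trans ?_
  rw [Equiv.symm_apply_apply, ← apply_sortOrbits hρ hb h1, sortOrbits_sortOrbits]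

end Routing

/-! ### The cube -/

/-- The vertices of the `m`-dimensional cube. -/
abbrev Cube (m : ℕ) : Type := Fin m → Bool

namespace Cube

variable {m : ℕ}

/-- The coordinate `d`; it is `false` beyond the dimension. -/
def bit (d : ℕ) (x : Cube m) : Bool := if h : d < m then x ⟨d, h⟩ else false

/-- The neighbour in direction `d`; the identity beyond the dimension. -/
def flip (d : ℕ) (x : Cube m) : Cube m := fun j => if (j : ℕ) = d then !x j else x j

theorem bit_of_le {d : ℕ} (h : m ≤ d) (x : Cube m) : bit d x = false := by
  simp [bit, h.not_gt]

theorem flip_of_le {d : ℕ} (h : m ≤ d) (x : Cube m) : flip d x = x := by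
  ext j
  have : (j : ℕ) ≠ d := by have := j.2; omega
  simp [flip, this]

theorem ext_bit {x y : Cube m} (h : ∀ d, bit d x = bit d y) : x = y := by
  ext j
  simpa [bit] using h j

theorem bit_flip_self {d : ℕ} (h : d < m) (x : Cube m) : bit d (flip d x) = !bit d x := by
  simp [bit, flip, h]

theorem bit_flip_of_ne {d e : ℕ} (h : e ≠ d) (x : Cube m) : bit e (flip d x) = bit e x := by
  simp [bit, flip, h]

theorem flip_flip (d : ℕ) (x : Cube m) : flip d (flip d x) = x := by
  ext j
  by_cases h : (j : ℕ) = d <;> simp [flip, h]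

theorem flip_comm (d e : ℕ) (x : Cube m) : flip d (flip e x) = flip e (flip d x) := by
  ext j
  by_cases h : (j : ℕ) = d <;> by_cases h' : (j : ℕ) = e <;>
    simp only [flip, h, h', if_true, if_false] <;> split_ifs <;> rfl

/-- The stages of a Beneš network for a permutation. -/
theorem exists_benes_network (n : ℕ) (hn : n ≤ m) (π : Equiv.Perm (Cube m))
    (hπ : ∀ d x, n ≤ d → bit d (π x) = bit d x) :
    ∃ s : ℕ → Equiv.Perm (Cube m), (∀ i, n ≤ i → s i = π) ∧
      (∀ i d x, i ≤ d → bit d (s i x) = bit d x) ∧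
      ∀ i z, ∃ x, (x = z ∨ x = flip i z) ∧
        (s i x = s (i + 1) z ∨ s i x = flip i (s (i + 1) z)) := by
  induction n generalizing π with
  | zero =>
    exact ⟨fun _ => π, fun _ _ => rfl, fun i d x _ => hπ d x (Nat.zero_le d),
      fun i z => ⟨z, Or.inl rfl, Or.inl rfl⟩⟩
  | succ n ih =>
    obtain ⟨σ, τ, π', hσ, hσ1, hτ, hπ', hbit⟩ := exists_benes_stage (b := bit n)
      (flip_flip (m := m) n) (bit_flip_self (by omega)) π
    have hpres : ∀ d x, n ≤ d → bit d (π' x) = bit d x := by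
      intro d x hd
      rcases hd.eq_or_lt with rfl | hd
      · exact hbit x
      · have hor : ∀ {y z : Cube m}, y = z ∨ y = flip n z → bit d y = bit d z := by
          rintro y z (rfl | rfl)
          · rfl
          · exact bit_flip_of_ne hd.ne' z
        rw [hπ', hor (hτ _), hπ d _ hd, hor (hσ1 _)]
    obtain ⟨s, h1, h2, h3⟩ := ih (by omega) π' hpres
    -- The inductive stages end with `s n = π'`; the original permutation is put on top of them.
    refine ⟨fun i => if i ≤ n then s i else π, fun i hi => if_neg (by omega),
      fun i d x hd => ?_, fun i z => ?_⟩
    · by_cases hi : i ≤ n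
      · simpa only [if_pos hi] using h2 i d x hd
      · simpa only [if_neg hi] using hπ d x (by omega)
    · rcases lt_trichotomy i n with hi | rfl | hi
      · simpa only [if_pos hi.le, if_pos (Nat.succ_le_of_lt hi)] using h3 i z
      -- Since `π' = τ π σ` and `σ` is an involution, `π' (σ z) = τ (π z)`.
      · refine ⟨σ z, hσ1 z, ?_⟩
        simp only [le_refl, if_true, Nat.not_succ_le_self, if_false]
        rw [h1 i le_rfl, hπ', hσ]
        exact hτ _
      · refine ⟨z, Or.inl rfl, Or.inl ?_⟩
        simp only [if_neg hi.not_ge, if_neg (show ¬ i + 1 ≤ n by omega)]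

/-! ### Gray code directions -/

/-- The directions in which a vertex of the cube has a neighbour in the Gray code path: direction
`0` and the direction following the lowest nonzero coordinate. -/
def IsGray (d : ℕ) (x : Cube m) : Prop :=
  d = 0 ∨ (bit (d - 1) x = true ∧ ∀ e < d - 1, bit e x = false)

/-- Whether direction `d` is allowed depends only on coordinates below `d`. Hence a Gray edge
persists after a flip in a higher direction, and the two span a square. -/
theorem isGray_flip {d e : ℕ} (h : d ≤ e) {x : Cube m} (hx : IsGray d x) :
    IsGray d (flip e x) := by
  rcases Nat.eq_zero_or_pos d with h0 | h0
  · exact Or.inl h0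
  · obtain ⟨h1, h2⟩ := hx.resolve_left h0.ne'
    refine Or.inr ⟨?_, fun k hk => ?_⟩
    · rw [bit_flip_of_ne (by omega), h1]
    · rw [bit_flip_of_ne (by omega), h2 k hk]

theorem isGray_unique {d e : ℕ} {x : Cube m} (hd : IsGray d x) (he : IsGray e x) (hd0 : d ≠ 0)
    (he0 : e ≠ 0) : d = e := by
  obtain ⟨h1, h2⟩ := hd.resolve_left hd0
  obtain ⟨h3, h4⟩ := he.resolve_left he0
  rcases lt_trichotomy (d - 1) (e - 1) with h | h | h
  · rw [h4 _ h] at h1; cases h1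
  · omega
  · rw [h2 _ h] at h3; cases h3

/-- The coordinates below `n` are corrected one at a time, from the highest down. -/
theorem eq_of_flip_invariant {α : Type*} (h : Cube m → α) (n : ℕ)
    (hinv : ∀ d < n, ∀ x, h (flip d x) = h x) {x y : Cube m}
    (hxy : ∀ d, n ≤ d → bit d x = bit d y) : h x = h y := by
  induction n generalizing x with
  | zero => rw [ext_bit fun d => hxy d (Nat.zero_le d)]
  | succ n ih =>
    have ih' := fun {x} => ih (fun d hd => hinv d (by omega)) (x := x)
    by_cases hn : bit n x = bit n y
    · refine ih' fun d hd => ?_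
      rcases hd.eq_or_lt with rfl | hd
      · exact hn
      · exact hxy d hd
    · have hnm : n < m := by
        by_contra hnm
        exact hn (by rw [bit_of_le (by omega), bit_of_le (by omega)])
      rw [← hinv n (by omega) x]
      refine ih' fun d hd => ?_
      rcases hd.eq_or_lt with rfl | hd
      · rw [bit_flip_self hnm]
        revert hn
        cases bit n x <;> cases bit n y <;> simp
      · rw [bit_flip_of_ne hd.ne']
        exact hxy d hd

/-- The Gray code path is connected. -/
theorem flip_invariant_of_gray_invariant {α : Type*} (h : Cube m → α) (n : ℕ)
    (hinv : ∀ d < n, ∀ x, IsGray d x → h (flip d x) = h x) :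
    ∀ d < n, ∀ x, h (flip d x) = h x := by
  induction n with
  | zero => intro d hd; omega
  | succ n ih =>
    have ih' := ih fun d hd => hinv d (by omega)
    intro d hd x
    rcases (Nat.lt_succ_iff.1 hd).lt_or_eq with hd | rfl
    · exact ih' d hd x
    by_cases hdm : m ≤ d
    · rw [flip_of_le hdm]
    -- By induction the lower coordinates may be moved freely. They are set to the one pattern, `1`
    -- in position `d - 1` only, at which direction `d` is allowed; after the flip they are moved
    -- back.
    let x' : Cube m := fun j => if (j : ℕ) < d then decide ((j : ℕ) = d - 1) else x j
    have hx' : ∀ e, d ≤ e → bit e x' = bit e x := fun e he => by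
      by_cases hem : e < m <;> simp [bit, hem, x', he.not_gt]
    have hlow : ∀ e, e < d → bit e x' = decide (e = d - 1) := fun e he => by
      simp [bit, x', show e < m by omega, he]
    have hgray : IsGray d x' := by
      rcases Nat.eq_zero_or_pos d with h0 | h0
      · exact Or.inl h0
      · refine Or.inr ⟨by rw [hlow _ (by omega)]; simp, fun e he => ?_⟩
        rw [hlow _ (by omega)]
        simpa using he.ne
    rw [← eq_of_flip_invariant h d ih' hx', ← hinv d (by omega) x' hgray]
    refine eq_of_flip_invariant h d ih' fun e he => ?_
    rcases he.eq_or_lt with rfl | he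
    · rw [bit_flip_self (by omega), bit_flip_self (by omega), hx' _ le_rfl]
    · rw [bit_flip_of_ne he.ne', bit_flip_of_ne he.ne', hx' _ he.le]

end Cube

/-! ### Graphs whose cycles are generated by short cycles -/

/-- The reflexive closure of the adjacency relation. -/
def Near {V : Type} (G : SimpleGraph V) (u v : V) : Prop := u = v ∨ G.Adj u v

theorem Near.symm {V : Type} {G : SimpleGraph V} {u v : V} (h : Near G u v) : Near G v u :=
  h.imp Eq.symm SimpleGraph.Adj.symm

/-- Each edge labelling that vanishes on closed walks of length at most four is a coboundary. -/
def IsFilled {V : Type} (G : SimpleGraph V) : Prop :=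
  ∀ w : V → V → ZMod 2, (∀ u, w u u = 0) → (∀ u v, w u v = w v u) →
    (∀ a b c d, Near G a b → Near G b c → Near G c d → Near G d a →
      w a b + w b c + w c d + w d a = 0) →
    ∃ φ : V → ZMod 2, ∀ u v, G.Adj u v → w u v = φ u + φ v

/-! ### The layered routing graph -/

namespace Cube

variable {m : ℕ} {ι : Type}

/-- The horizontal edges of the routing graph in layer `i`, for routing sequences `s j`. -/
def LayerEdge (s : ι → ℕ → Equiv.Perm (Cube m)) (i : ℕ) (x y : Cube m) : Prop :=
  y = flip i x ∨ (∃ d ≤ i, IsGray d x ∧ y = flip d x) ∨ (∃ j, y = s j i x) ∨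
    ∃ j, y = s j (i + 1) x

/-- The edges of a layer, with loops. -/
def LayerNear (s : ι → ℕ → Equiv.Perm (Cube m)) (i : ℕ) (x y : Cube m) : Prop :=
  x = y ∨ LayerEdge s i x y ∨ LayerEdge s i y x

theorem LayerNear.symm {s : ι → ℕ → Equiv.Perm (Cube m)} {i : ℕ} {x y : Cube m}
    (h : LayerNear s i x y) : LayerNear s i y x :=
  h.imp Eq.symm Or.symm

/-- The compatibility conditions on the routing sequences: they are the stages of Beneš
networks. -/
structure IsRouting (s : ι → ℕ → Equiv.Perm (Cube m)) : Prop where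
  bit_eq : ∀ j i d x, i ≤ d → bit d (s j i x) = bit d x
  stage : ∀ j i z, ∃ x, (x = z ∨ x = flip i z) ∧
    (s j i x = s j (i + 1) z ∨ s j i x = flip i (s j (i + 1) z))

variable {s : ι → ℕ → Equiv.Perm (Cube m)}

/-- This makes it harmless to correct a potential by a function of the higher coordinates: on the
layers already treated the correction is constant along edges. -/
theorem LayerEdge.bit_eq (hs : IsRouting s) {i : ℕ} {x y : Cube m} (h : LayerEdge s i x y)
    {d : ℕ} (hd : i < d) : bit d y = bit d x := by
  rcases h with rfl | ⟨e, he, -, rfl⟩ | ⟨j, rfl⟩ | ⟨j, rfl⟩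
  · exact bit_flip_of_ne (by omega) x
  · exact bit_flip_of_ne (by omega) x
  · exact hs.bit_eq j i d x (by omega)
  · exact hs.bit_eq j (i + 1) d x hd

/-- Layer by layer, labels that are compatible on squares are found to be a coboundary. -/
theorem exists_layer_potential (hs : IsRouting s) (u : ℕ → Cube m → Cube m → ZMod 2)
    (hself : ∀ i x, u i x x = 0) (hsymm : ∀ i x y, u i x y = u i y x)
    (hquad : ∀ i ≤ m, ∀ a b c d, LayerNear s i a b → LayerNear s i b c → LayerNear s i c d →
      LayerNear s i d a → u i a b + u i b c + u i c d + u i d a = 0)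
    (hvert : ∀ i < m, ∀ x y, LayerNear s i x y → LayerNear s (i + 1) x y →
      u i x y = u (i + 1) x y) (n : ℕ) (hn : n ≤ m + 1) :
    ∃ g : Cube m → ZMod 2, ∀ i < n, ∀ x y, LayerEdge s i x y → u i x y = g x + g y := by
  have two : ∀ t : ZMod 2, t + t = 0 := by decide
  induction n with
  | zero => exact ⟨0, fun i hi => by omega⟩
  | succ n ih =>
    obtain ⟨g, hg⟩ := ih (by omega)
    have hnm : n ≤ m := by omega
    have hflip : ∀ x, LayerNear s n x (flip n x) := fun x => Or.inr (Or.inl (Or.inl rfl))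
    have hgray_near : ∀ d ≤ n, ∀ x, IsGray d x → LayerNear s n x (flip d x) :=
      fun d hd x hx => Or.inr (Or.inl (Or.inr (Or.inl ⟨d, hd, hx, rfl⟩)))
    have hs_near : ∀ j x, LayerNear s n x (s j n x) :=
      fun j x => Or.inr (Or.inl (Or.inr (Or.inr (Or.inl ⟨j, rfl⟩))))
    have hs1_near : ∀ j x, LayerNear s n x (s j (n + 1) x) :=
      fun j x => Or.inr (Or.inl (Or.inr (Or.inr (Or.inr ⟨j, rfl⟩))))
    have hgray : ∀ d < n, ∀ x, IsGray d x → u n x (flip d x) = g x + g (flip d x) := by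
      intro d hd x hx
      obtain ⟨k, rfl⟩ : ∃ k, n = k + 1 := ⟨n - 1, by omega⟩
      have he : LayerEdge s k x (flip d x) := Or.inr (Or.inl ⟨d, by omega, hx, rfl⟩)
      rw [← hvert k (by omega) x _ (Or.inr (Or.inl he)) (hgray_near d hd.le x hx),
        hg k (by omega) x _ he]
    have hroute : ∀ j x, u n x (s j n x) = g x + g (s j n x) := by
      intro j x
      rcases Nat.eq_zero_or_pos n with rfl | h0
      -- Stage `0` fixes all coordinates and is the identity; later stages already occur in the
      -- layer below.
      · rw [ext_bit fun d => hs.bit_eq j 0 d x (Nat.zero_le d), hself, two]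
      · obtain ⟨k, rfl⟩ : ∃ k, n = k + 1 := ⟨n - 1, by omega⟩
        have he : LayerEdge s k x (s j (k + 1) x) := Or.inr (Or.inr (Or.inr ⟨j, rfl⟩))
        rw [← hvert k (by omega) x _ (Or.inr (Or.inl he)) (hs_near j x), hg k (by omega) x _ he]
    -- The defect of the old potential in the only new flip direction. Squares with Gray edges show
    -- that it is constant on subcubes of the first `n + 1` coordinates.
    let h : Cube m → ZMod 2 := fun x => u n x (flip n x) + g x + g (flip n x)
    have hh_flip : ∀ x, h (flip n x) = h x := fun x => by
      simp only [h, flip_flip, hsymm n (flip n x) x]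
      ring
    have hh_gray : ∀ d < n, ∀ x, IsGray d x → h (flip d x) = h x := by
      intro d hd x hx
      have hx' := isGray_flip hd.le hx
      have hq := hquad n hnm x (flip d x) (flip n (flip d x)) (flip n x)
        (hgray_near d hd.le x hx) (hflip _)
        (by rw [flip_comm n d]; exact (hgray_near d hd.le _ hx').symm) (hflip x).symm
      have h1 := hgray d hd x hx
      have h2 := hgray d hd (flip n x) hx'
      rw [hsymm n (flip n (flip d x)), flip_comm n d x, h1, h2, hsymm n (flip n x)] at hq
      simp only [h, flip_comm n d x]
      generalize u n (flip d x) (flip d (flip n x)) = t1 at *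
      generalize u n x (flip n x) = t2 at *
      generalize g x = t3 at *
      generalize g (flip d x) = t4 at *
      generalize g (flip n x) = t5 at *
      generalize g (flip d (flip n x)) = t6 at *
      clear * - hq
      revert t1 t2 t3 t4 t5 t6
      decide
    have hh : ∀ x y, (∀ d, n + 1 ≤ d → bit d x = bit d y) → h x = h y := fun x y hxy => by
      refine eq_of_flip_invariant h (n + 1) (fun d hd x => ?_) hxy
      rcases (Nat.lt_succ_iff.1 hd).lt_or_eq with hd | rfl
      · exact flip_invariant_of_gray_invariant h n hh_gray d hd x
      · exact hh_flip x
    -- Adding the defect on one half of the cube repairs direction `n`. As `h` ignores coordinates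
    -- up to `n`, the correction depends only on coordinates from `n` on.
    let k : Cube m → ZMod 2 := fun x => if bit n x then h x else 0
    have hk : ∀ x y, (∀ d, n ≤ d → bit d y = bit d x) → k y = k x := fun x y hxy => by
      simp only [k, hxy n le_rfl, hh y x fun d hd => hxy d (by omega)]
    have hnew : ∀ x, u n x (flip n x) = (g x + k x) + (g (flip n x) + k (flip n x)) := by
      intro x
      by_cases hlt : n < m
      · have hkk : k x + k (flip n x) = h x := by
          simp only [k, bit_flip_self hlt, hh_flip]
          cases bit n x <;> simp
        rw [add_add_add_comm, hkk]
        simp only [h]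
        linear_combination -(two (g x)) - two (g (flip n x))
      -- In the top layer `n = m`, and the new direction lies beyond the dimension.
      · rw [flip_of_le (by omega), hself, two]
    have hgray' : ∀ d ≤ n, ∀ x, IsGray d x →
        u n x (flip d x) = (g x + k x) + (g (flip d x) + k (flip d x)) := by
      intro d hd x hx
      rcases hd.lt_or_eq with hd | rfl
      · rw [hgray d hd x hx, hk x (flip d x) fun e he => bit_flip_of_ne (by omega) x]
        linear_combination -two (k x)
      · exact hnew x
    have hroute' : ∀ j x, u n x (s j n x) = (g x + k x) + (g (s j n x) + k (s j n x)) := by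
      intro j x
      rw [hroute j x, hk x (s j n x) fun e he => hs.bit_eq j n e x he]
      linear_combination -two (k x)
    have hmaybe : ∀ x y, (y = x ∨ y = flip n x) →
        u n x y = (g x + k x) + (g y + k y) ∧ LayerNear s n x y := by
      rintro x y (rfl | rfl)
      · exact ⟨by rw [hself, two], Or.inl rfl⟩
      · exact ⟨hnew x, hflip x⟩
    refine ⟨fun x => g x + k x, fun i hi x y he => ?_⟩
    change u i x y = (g x + k x) + (g y + k y)
    rcases (Nat.lt_succ_iff.1 hi).lt_or_eq with hi | rfl
    · rw [hg i hi x y he, hk x y fun d hd => he.bit_eq hs (by omega)]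
      linear_combination -two (k x)
    · rcases he with rfl | ⟨d, hd, hx, rfl⟩ | ⟨j, rfl⟩ | ⟨j, rfl⟩
      · exact hnew x
      · exact hgray' d hd x hx
      · exact hroute' j x
      -- An edge of stage `i + 1` closes a square with an edge of stage `i` and at most two flips,
      -- whose labels are already known.
      · obtain ⟨x', hx', hy'⟩ := hs.stage j i x
        obtain ⟨h1, n1⟩ := hmaybe x x' hx'
        obtain ⟨h2, n2⟩ := hmaybe _ _ hy'
        have hq := hquad i hnm x x' (s j i x') (s j (i + 1) x) n1 (hs_near j x') n2.symm
          (hs1_near j x).symm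
        rw [h1, hroute', hsymm i (s j i x'), h2, hsymm i _ x] at hq
        linear_combination hq - two (g x' + k x') - two (g (s j i x') + k (s j i x'))
          - two (g x + k x) - two (g (s j (i + 1) x) + k (s j (i + 1) x))

/-- The routing graph: `m + 1` layers of cubes with the edges of `LayerEdge`, and vertical
edges. -/
def routingGraph (s : ι → ℕ → Equiv.Perm (Cube m)) : SimpleGraph (Cube m × Fin (m + 1)) :=
  SimpleGraph.fromRel fun p q =>
    (p.2 = q.2 ∧ LayerEdge s p.2 p.1 q.1) ∨ (p.1 = q.1 ∧ (p.2 : ℕ) + 1 = q.2)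

theorem near_routingGraph {i : Fin (m + 1)} {x y : Cube m} (h : LayerNear s i x y) :
    Near (routingGraph s) (x, i) (y, i) := by
  by_cases hxy : x = y
  · exact Or.inl (by rw [hxy])
  · right
    rw [routingGraph, SimpleGraph.fromRel_adj]
    refine ⟨by simpa using hxy, ?_⟩
    rcases h.resolve_left hxy with h | h
    · exact Or.inl (Or.inl ⟨rfl, h⟩)
    · exact Or.inr (Or.inl ⟨rfl, h⟩)

theorem adj_routingGraph_vertical (s : ι → ℕ → Equiv.Perm (Cube m)) (x : Cube m)
    {i j : Fin (m + 1)} (h : (i : ℕ) + 1 = j) : (routingGraph s).Adj (x, i) (x, j) := by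
  rw [routingGraph, SimpleGraph.fromRel_adj]
  refine ⟨fun he => ?_, Or.inl (Or.inr ⟨rfl, h⟩)⟩
  have := congrArg (fun p => (p.2 : ℕ)) he
  simp only at this
  omega

/-- The layer `i`, or the last one if `i` is too large. -/
def layer (m i : ℕ) : Fin (m + 1) := ⟨min i m, by omega⟩

theorem layer_val {i : ℕ} (h : i ≤ m) : (layer m i : ℕ) = i := min_eq_left h

theorem layer_coe (i : Fin (m + 1)) : layer m i = i :=
  Fin.ext (layer_val (Nat.lt_succ_iff.1 i.2))

/-- Subtracting the coboundary of the partial sums `φ` along the columns makes all vertical labels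
vanish. Vertical squares then force equal labels on edges common to consecutive layers, so one
potential on the cube serves every layer. -/
theorem isFilled_routingGraph (hs : IsRouting s) : IsFilled (routingGraph s) := by
  intro w hself hsymm hquad
  have two : ∀ t : ZMod 2, t + t = 0 := by decide
  let t : Cube m → ℕ → ZMod 2 := fun x i => w (x, layer m i) (x, layer m (i + 1))
  let φ : Cube m → ℕ → ZMod 2 := fun x i => ∑ k ∈ Finset.range i, t x k
  have hφ : ∀ x i, φ x (i + 1) = φ x i + t x i := fun x i => Finset.sum_range_succ _ _
  have near : ∀ i ≤ m, ∀ {x y}, LayerNear s i x y →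
      Near (routingGraph s) (x, layer m i) (y, layer m i) := fun i hi x y h =>
    near_routingGraph (by rwa [layer_val hi])
  have near_vert : ∀ i < m, ∀ x,
      Near (routingGraph s) (x, layer m i) (x, layer m (i + 1)) := fun i hi x =>
    Or.inr (adj_routingGraph_vertical s x (by rw [layer_val hi.le, layer_val hi]))
  obtain ⟨g, hg⟩ := exists_layer_potential hs
    (fun i x y => w (x, layer m i) (y, layer m i) + φ x i + φ y i)
    (fun i x => by rw [hself, zero_add, two]) (fun i x y => by rw [hsymm]; ring)
    (fun i hi a b c d hab hbc hcd hda => by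
      have := hquad _ _ _ _ (near i hi hab) (near i hi hbc) (near i hi hcd) (near i hi hda)
      linear_combination this + two (φ a i) + two (φ b i) + two (φ c i) + two (φ d i))
    (fun i hi x y h h' => by
      have := hquad _ _ _ _ (near i hi.le h) (near_vert i hi y) (near (i + 1) hi h').symm
        (near_vert i hi x).symm
      rw [hsymm (y, layer m (i + 1)), hsymm (x, layer m (i + 1)) (x, layer m i)] at this
      simp only [hφ, t]
      linear_combination this - two (w (y, layer m i) (y, layer m (i + 1)))
        - two (w (x, layer m (i + 1)) (y, layer m (i + 1)))
        - two (w (x, layer m i) (x, layer m (i + 1)))) (m + 1) le_rfl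
  have hedge : ∀ p q : Cube m × Fin (m + 1),
      ((p.2 = q.2 ∧ LayerEdge s p.2 p.1 q.1) ∨ (p.1 = q.1 ∧ (p.2 : ℕ) + 1 = q.2)) →
      w p q = (g p.1 + φ p.1 p.2) + (g q.1 + φ q.1 q.2) := by
    rintro ⟨x, i⟩ ⟨y, j⟩ (⟨hij, h⟩ | ⟨hxy, h⟩)
    · simp only at hij h ⊢
      subst hij
      have := hg i i.2 x y h
      rw [layer_coe] at this
      linear_combination this - two (φ x i) - two (φ y i)
    · simp only at hxy h ⊢
      subst hxy
      have h1 : t x i = w (x, i) (x, j) := by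
        simp only [t]
        rw [layer_coe, h, layer_coe]
      rw [← h, hφ, h1]
      linear_combination - two (g x) - two (φ x i)
  refine ⟨fun p => g p.1 + φ p.1 p.2, fun p q hpq => ?_⟩
  rw [routingGraph, SimpleGraph.fromRel_adj] at hpq
  rcases hpq.2 with h | h
  · exact hedge p q h
  · rw [hsymm, hedge q p h, add_comm]

/-- Columns lead to the top layer, which contains the whole Gray code path. -/
theorem connected_routingGraph (s : ι → ℕ → Equiv.Perm (Cube m)) :
    (routingGraph s).Connected := by
  have near_reach : ∀ {p q}, Near (routingGraph s) p q → (routingGraph s).Reachable p q := by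
    rintro p q (rfl | h)
    · exact SimpleGraph.Reachable.refl _
    · exact h.reachable
  let x₀ : Cube m := fun _ => false
  have hup : ∀ (k : ℕ), k ≤ m → ∀ x,
      (routingGraph s).Reachable (x, layer m (m - k)) (x, layer m m) := by
    intro k
    induction k with
    | zero => intro _ x; exact SimpleGraph.Reachable.refl _
    | succ k ih =>
      intro hk x
      refine SimpleGraph.Reachable.trans ?_ (ih (by omega) x)
      refine (adj_routingGraph_vertical s x ?_).reachable
      rw [layer_val (by omega), layer_val (by omega)]
      omega
  have htop : ∀ x, (routingGraph s).Reachable (x₀, layer m m) (x, layer m m) := by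
    intro x
    have hinv : ∀ d < m, ∀ y, IsGray d y →
        (routingGraph s).Reachable (x₀, layer m m) (flip d y, layer m m) =
          (routingGraph s).Reachable (x₀, layer m m) (y, layer m m) := by
      intro d hd y hy
      have hstep : (routingGraph s).Reachable (y, layer m m) (flip d y, layer m m) :=
        near_reach (near_routingGraph (Or.inr (Or.inl (Or.inr (Or.inl
          ⟨d, by rw [layer_val le_rfl]; exact hd.le, hy, rfl⟩)))))
      exact propext ⟨fun h => h.trans hstep.symm, fun h => h.trans hstep⟩
    have := eq_of_flip_invariant
      (fun y => (routingGraph s).Reachable (x₀, layer m m) (y, layer m m)) m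
      (flip_invariant_of_gray_invariant
        (fun y => (routingGraph s).Reachable (x₀, layer m m) (y, layer m m)) m hinv) (x := x) (y := x₀)
      fun d hd => by rw [bit_of_le hd, bit_of_le hd]
    exact this ▸ SimpleGraph.Reachable.refl _
  have hall : ∀ p, (routingGraph s).Reachable (x₀, layer m m) p := by
    rintro ⟨x, i⟩
    have := hup (m - i) (by omega) x
    rw [show m - (m - (i : ℕ)) = i by omega, layer_coe] at this
    exact (htop x).trans this.symm
  exact (SimpleGraph.connected_iff _).2
    ⟨fun p q => (hall p).symm.trans (hall q), ⟨(x₀, layer m m)⟩⟩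

theorem card_gray_le (n : ℕ) (x : Cube m) [DecidablePred fun d => IsGray d x] :
    ((Finset.range n).filter fun d => IsGray d x).card ≤ 2 := by
  have h : ((Finset.range n).filter fun d => IsGray d x) ⊆
      insert 0 (((Finset.range n).filter fun d => IsGray d x).filter (· ≠ 0)) := by
    intro d hd
    by_cases h0 : d = 0
    · simp [h0]
    · exact Finset.mem_insert_of_mem (Finset.mem_filter.2 ⟨hd, h0⟩)
  refine (Finset.card_le_card h).trans ((Finset.card_insert_le _ _).trans ?_)
  refine Nat.succ_le_succ (Finset.card_le_one.2 fun d hd e he => ?_)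
  simp only [Finset.mem_filter] at hd he
  exact isGray_unique hd.1.2 he.1.2 hd.2 he.2

open Classical in
theorem exists_neighbors_routingGraph [Fintype ι] (s : ι → ℕ → Equiv.Perm (Cube m))
    (p : Cube m × Fin (m + 1)) :
    ∃ N : Finset (Cube m × Fin (m + 1)), N.card ≤ 4 * Fintype.card ι + 5 ∧
      ∀ q, (routingGraph s).Adj p q → q ∈ N := by
  obtain ⟨x, i⟩ := p
  let H : Finset (Cube m) := {flip i x} ∪
    ((Finset.range (i + 1)).filter fun d => IsGray d x).image (fun d => flip d x) ∪
    Finset.univ.image (fun j => s j i x) ∪ Finset.univ.image (fun j => (s j i).symm x) ∪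
    Finset.univ.image (fun j => s j (i + 1) x) ∪ Finset.univ.image (fun j => (s j (i + 1)).symm x)
  have hH : ∀ y, LayerEdge s i x y ∨ LayerEdge s i y x → y ∈ H := by
    simp only [H, Finset.mem_union, Finset.mem_singleton, Finset.mem_image, Finset.mem_filter,
      Finset.mem_range, Finset.mem_univ, true_and]
    rintro y ((h | ⟨d, hd, hx, h⟩ | ⟨j, h⟩ | ⟨j, h⟩) | (h | ⟨d, hd, hx, h⟩ | ⟨j, h⟩ | ⟨j, h⟩))
    · simp [h]
    · exact Or.inl (Or.inl (Or.inl (Or.inl (Or.inr ⟨d, ⟨by omega, hx⟩, h.symm⟩))))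
    · exact Or.inl (Or.inl (Or.inl (Or.inr ⟨j, h.symm⟩)))
    · exact Or.inl (Or.inr ⟨j, h.symm⟩)
    · simp [h, flip_flip]
    · refine Or.inl (Or.inl (Or.inl (Or.inl (Or.inr ⟨d, ⟨by omega, ?_⟩, ?_⟩))))
      · rw [h]; exact isGray_flip le_rfl hx
      · rw [h, flip_flip]
    · exact Or.inl (Or.inl (Or.inr ⟨j, by rw [h, Equiv.symm_apply_apply]⟩))
    · exact Or.inr ⟨j, by rw [h, Equiv.symm_apply_apply]⟩
  have hcard : H.card ≤ 4 * Fintype.card ι + 3 := by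
    have h1 : (((Finset.range (i + 1)).filter fun d => IsGray d x).image
        (fun d => flip d x)).card ≤ 2 := Finset.card_image_le.trans (card_gray_le _ x)
    have h2 : ∀ f : ι → Cube m, (Finset.univ.image f).card ≤ Fintype.card ι :=
      fun f => Finset.card_image_le
    have h3 := h2 fun j => s j i x
    have h4 := h2 fun j => (s j i).symm x
    have h5 := h2 fun j => s j (i + 1) x
    have h6 := h2 fun j => (s j (i + 1)).symm x
    have h7 : H.card ≤ 1 + 2 + Fintype.card ι + Fintype.card ι + Fintype.card ι +
        Fintype.card ι := by
      refine (Finset.card_union_le _ _).trans (add_le_add ?_ h6)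
      refine (Finset.card_union_le _ _).trans (add_le_add ?_ h5)
      refine (Finset.card_union_le _ _).trans (add_le_add ?_ h4)
      refine (Finset.card_union_le _ _).trans (add_le_add ?_ h3)
      exact (Finset.card_union_le _ _).trans (add_le_add (Finset.card_singleton _).le h1)
    omega
  -- At the top and bottom layers the indices are clamped, which only adds superfluous candidates.
  refine ⟨H.image (fun y => (y, i)) ∪ {(x, layer m (i + 1)), (x, layer m (i - 1))}, ?_, ?_⟩
  · refine (Finset.card_union_le _ _).trans ?_
    have h1 : (H.image fun y => (y, i)).card ≤ H.card := Finset.card_image_le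
    have h2 : ({(x, layer m (i + 1)), (x, layer m (i - 1))} :
      Finset (Cube m × Fin (m + 1))).card ≤ 2 := Finset.card_le_two
    omega
  · rintro ⟨y, j⟩ h
    rw [routingGraph, SimpleGraph.fromRel_adj] at h
    simp only [Finset.mem_union, Finset.mem_image, Finset.mem_insert, Finset.mem_singleton,
      Prod.mk.injEq]
    rcases h.2 with (⟨h1, h2⟩ | ⟨h1, h2⟩) | (⟨h1, h2⟩ | ⟨h1, h2⟩) <;> simp only at h1 h2
    · exact Or.inl ⟨y, hH y (Or.inl h2), rfl, h1⟩
    · exact Or.inr (Or.inl ⟨h1.symm, by rw [h2, layer_coe]⟩)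
    · subst h1
      exact Or.inl ⟨y, hH y (Or.inr h2), rfl, rfl⟩
    · refine Or.inr (Or.inr ⟨h1, ?_⟩)
      rw [← h2, Nat.add_sub_cancel, layer_coe]

/-- For each family of permutations of the `2 ^ m` ports there is a bounded degree graph with
`(m + 1) * 2 ^ m` vertices in which all cycles are generated by short cycles, and ports that
correspond under one of the permutations are adjacent. -/
theorem exists_routingGraph (m : ℕ) [Fintype ι] (π : ι → Equiv.Perm (Cube m)) :
    ∃ G : SimpleGraph (Cube m × Fin (m + 1)), G.Connected ∧ IsFilled G ∧
      (∀ p, ∃ N : Finset (Cube m × Fin (m + 1)), N.card ≤ 4 * Fintype.card ι + 5 ∧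
        ∀ q, G.Adj p q → q ∈ N) ∧
      ∀ j x, Near G (x, Fin.last m) (π j x, Fin.last m) := by
  -- With `n = m` the compatibility hypothesis concerns no actual coordinate, so every permutation
  -- is admissible.
  choose s h1 h2 h3 using fun j => exists_benes_network m le_rfl (π j) fun d x hd => by
    rw [bit_of_le hd, bit_of_le hd]
  refine ⟨routingGraph s, connected_routingGraph s, isFilled_routingGraph ⟨h2, h3⟩,
    exists_neighbors_routingGraph s, fun j x => near_routingGraph ?_⟩
  exact Or.inr (Or.inl (Or.inr (Or.inr (Or.inl ⟨j, by rw [Fin.val_last, h1 j m le_rfl]⟩))))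

end Cube

/-! ### Sparse cycle bases -/

section CycleBasis

variable {V : Type} [DecidableEq V] {G : SimpleGraph V}

/-- The edge set of a closed walk of length four. -/
def quad (G : SimpleGraph V) (a b c d : V) : G.edgeSet → ZMod 2 :=
  edgeVec G a b + edgeVec G b c + edgeVec G c d + edgeVec G d a

/-- The edge sets of closed walks of length at most four. -/
def quads (G : SimpleGraph V) : Set (G.edgeSet → ZMod 2) :=
  {z | ∃ a b c d, Near G a b ∧ Near G b c ∧ Near G c d ∧ Near G d a ∧ z = quad G a b c d}

theorem ncard_quad_le {z : G.edgeSet → ZMod 2} (hz : z ∈ quads G) :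
    {e | z e ≠ 0}.ncard ≤ 4 := by
  obtain ⟨a, b, c, d, -, -, -, -, rfl⟩ := hz
  rw [← Set.ncard_image_of_injective _ Subtype.val_injective]
  refine (Set.ncard_le_ncard (t := (({s(a, b), s(b, c), s(c, d), s(d, a)} : Finset (Sym2 V)) :
    Set (Sym2 V))) ?_ (Finset.finite_toSet _)).trans ?_
  · rintro _ ⟨e, he, rfl⟩
    simp only [Finset.coe_insert, Finset.coe_singleton, Set.mem_insert_iff,
      Set.mem_singleton_iff]
    by_contra! h
    simp [quad, edgeVec, h.1, h.2.1, h.2.2.1, h.2.2.2] at he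
  · rw [Set.ncard_coe_finset]
    exact Finset.card_le_four

theorem quad_rotate (a b c d : V) : quad G b c d a = quad G a b c d := by
  simp only [quad]; abel

theorem quad_reverse (a b c d : V) : quad G b a d c = quad G a b c d := by
  simp only [quad, edgeVec_swap G b a, edgeVec_swap G a d, edgeVec_swap G d c,
    edgeVec_swap G c b]
  abel

theorem ncard_incident_le {Δ : ℕ} {N : V → Finset V} (hN : ∀ v, (N v).card ≤ Δ)
    (hmem : ∀ u v, G.Adj u v → v ∈ N u) (v : V) :
    {e : G.edgeSet | v ∈ (e : Sym2 V)}.ncard ≤ Δ := by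
  rw [← Set.ncard_image_of_injective _ Subtype.val_injective]
  refine (Set.ncard_le_ncard (t := ((N v).image fun u => s(v, u) : Finset (Sym2 V))) ?_
    (Finset.finite_toSet _)).trans ?_
  · rintro _ ⟨⟨e, he⟩, hv, rfl⟩
    obtain ⟨u, rfl⟩ := Sym2.mem_iff_exists.1 hv
    exact Finset.mem_image.2 ⟨u, hmem _ _ he, rfl⟩
  · rw [Set.ncard_coe_finset]
    exact Finset.card_image_le.trans (hN v)

variable [Fintype V] [DecidableRel G.Adj]

/-- Duality: a functional that kills the short closed walks labels the edges by a coboundary, and a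
coboundary pairs to zero with every cycle. -/
theorem span_quads (hG : IsFilled G) :
    Submodule.span (ZMod 2) (quads G) = LinearMap.ker (incidence G).vecMulLinear := by
  have two : ∀ x : V → ZMod 2, x + x = 0 := add_self_eq_zero_of_zmod2
  apply le_antisymm
  · rw [Submodule.span_le]
    rintro _ ⟨a, b, c, d, hab, hbc, hcd, hda, rfl⟩
    change quad G a b c d ᵥ* incidence G = 0
    rw [quad, add_vecMul, add_vecMul, add_vecMul, boundary_edgeVec hab, boundary_edgeVec hbc,
      boundary_edgeVec hcd, boundary_edgeVec hda]
    generalize (Pi.single a 1 : V → ZMod 2) = xa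
    generalize (Pi.single b 1 : V → ZMod 2) = xb
    generalize (Pi.single c 1 : V → ZMod 2) = xc
    generalize (Pi.single d 1 : V → ZMod 2) = xd
    calc xa + xb + (xb + xc) + (xc + xd) + (xd + xa) =
        (xa + xa) + (xb + xb) + (xc + xc) + (xd + xd) := by abel
      _ = 0 := by simp only [two]
  · intro c hc
    by_contra hcon
    obtain ⟨f, hfc, hf⟩ := Submodule.exists_le_ker_of_notMem hcon
    obtain ⟨φ, hφ⟩ := hG (fun u v => f (edgeVec G u v)) (fun u => by rw [edgeVec_self, map_zero])
      (fun u v => by rw [edgeVec_swap]) fun a b c d hab hbc hcd hda => by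
        have h : quad G a b c d ∈ LinearMap.ker f :=
          hf (Submodule.subset_span ⟨a, b, c, d, hab, hbc, hcd, hda, rfl⟩)
        rw [LinearMap.mem_ker, quad, map_add, map_add, map_add] at h
        exact h
    have hsingle : ∀ e, f (Pi.single e 1) = (incidence G *ᵥ φ) e := by
      rintro ⟨e, he⟩
      induction e with | _ u v
      rw [incidence_mulVec φ he, ← hφ u v he, edgeVec_eq_single G he]
    refine hfc ?_
    calc f c = c ⬝ᵥ (incidence G *ᵥ φ) := by
          conv_lhs => rw [← Finset.univ_sum_single c]
          simp only [map_sum, dotProduct]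
          refine Finset.sum_congr rfl fun e _ => ?_
          rw [← hsingle, show Pi.single e (c e) = c e • Pi.single e (1 : ZMod 2) by
            simp [← Pi.single_smul], map_smul, smul_eq_mul]
      _ = 0 := by
          rw [dotProduct_mulVec, show c ᵥ* incidence G = 0 from hc, zero_dotProduct]

/-- In a graph of bounded degree each edge lies on a bounded number of short cycles. -/
theorem ncard_quads_through_le {Δ : ℕ} {N : V → Finset V} (hN : ∀ v, (N v).card ≤ Δ)
    (hmem : ∀ u v, G.Adj u v → v ∈ N u) (e : G.edgeSet) :
    {z | z ∈ quads G ∧ z e ≠ 0}.ncard ≤ (Δ + 1) ^ 2 := by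
  obtain ⟨e, he⟩ := e
  induction e with | _ u v
  have hnear : ∀ {x y}, Near G x y → y ∈ insert x (N x) := by
    rintro x y (rfl | h)
    · exact Finset.mem_insert_self _ _
    · exact Finset.mem_insert_of_mem (hmem _ _ h)
  have hcard : ∀ x, (insert x (N x)).card ≤ Δ + 1 := fun x =>
    (Finset.card_insert_le _ _).trans (Nat.succ_le_succ (hN x))
  -- After rotation and reversal the walk starts with the given edge; each of its two other vertices
  -- lies in the closed neighbourhood of an end.
  have key : ∀ z a b c d, z = quad G a b c d → Near G a b → Near G b c → Near G c d →
      Near G d a → s(u, v) = s(a, b) →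
      z ∈ (insert v (N v) ×ˢ insert u (N u)).image fun p => quad G u v p.1 p.2 := by
    intro z a b c d hz hab hbc hcd hda h
    rcases Sym2.eq_iff.1 h with ⟨rfl, rfl⟩ | ⟨rfl, rfl⟩
    · exact Finset.mem_image.2 ⟨(c, d), Finset.mem_product.2 ⟨hnear hbc, hnear hda.symm⟩,
        hz.symm⟩
    · exact Finset.mem_image.2 ⟨(d, c), Finset.mem_product.2 ⟨hnear hda.symm, hnear hbc⟩,
        by rw [hz, ← quad_reverse]⟩
  refine (Set.ncard_le_ncard (t := ((insert v (N v) ×ˢ insert u (N u)).image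
    fun p => quad G u v p.1 p.2 : Finset (G.edgeSet → ZMod 2))) ?_
    (Finset.finite_toSet _)).trans ?_
  · rintro z ⟨⟨a, b, c, d, hab, hbc, hcd, hda, hz⟩, hne⟩
    have hone : s(u, v) = s(a, b) ∨ s(u, v) = s(b, c) ∨ s(u, v) = s(c, d) ∨
        s(u, v) = s(d, a) := by
      by_contra! h
      simp only [hz, quad, edgeVec, Pi.add_apply, h.1, h.2.1, h.2.2.1, h.2.2.2, if_false,
        add_zero, ne_eq, not_true_eq_false] at hne
    rcases hone with h | h | h | h
    · exact key z a b c d hz hab hbc hcd hda h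
    · exact key z b c d a (by rw [hz, quad_rotate a b c d]) hbc hcd hda hab h
    · exact key z c d a b (by rw [hz, quad_rotate b c d a, quad_rotate a b c d]) hcd hda hab hbc h
    · exact key z d a b c (by rw [hz, ← quad_rotate d a b c]) hda hab hbc hcd h
  · rw [Set.ncard_coe_finset, sq]
    refine Finset.card_image_le.trans ?_
    rw [Finset.card_product]
    exact Nat.mul_le_mul (hcard v) (hcard u)

theorem card_edgeSet_le {Δ : ℕ} {N : V → Finset V} (hN : ∀ v, (N v).card ≤ Δ)
    (hmem : ∀ u v, G.Adj u v → v ∈ N u) :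
    Fintype.card G.edgeSet ≤ Fintype.card V * Δ := by
  rw [← Finset.card_univ, ← Finset.card_image_of_injective _ Subtype.val_injective]
  refine (Finset.card_le_card (t := Finset.univ.biUnion fun v => (N v).image fun u => s(v, u))
    ?_).trans ?_
  · intro e he
    obtain ⟨⟨e, hadj⟩, -, rfl⟩ := Finset.mem_image.1 he
    induction e with | _ u v
    exact Finset.mem_biUnion.2 ⟨u, Finset.mem_univ _, Finset.mem_image.2 ⟨v, hmem _ _ hadj, rfl⟩⟩
  · exact Finset.card_biUnion_le_card_mul _ _ _ fun v _ => Finset.card_image_le.trans (hN v)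

end CycleBasis

/-! ### Covering a sparse relation by permutations -/

/-- The relation is a bijection between two subsets of a finite set, and such a bijection extends.
-/
theorem exists_perm_of_rel {X : Type} [Fintype X] (T : X → X → Prop)
    (hfun : ∀ x y y', T x y → T x y' → y = y') (hinj : ∀ x x' y, T x y → T x' y → x = x') :
    ∃ σ : Equiv.Perm X, ∀ x y, T x y → σ x = y := by
  classical
  choose f hf using fun x : {x // ∃ y, T x y} => x.2
  let F : {x // ∃ y, T x y} → {y // ∃ x, T x y} := fun x => ⟨f x, x, hf x⟩
  have hF : Function.Bijective F := by
    constructor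
    · intro x x' h
      have h' : f x = f x' := congrArg Subtype.val h
      exact Subtype.ext (hinj _ _ _ (hf x) (h' ▸ hf x'))
    · rintro ⟨y, x, hxy⟩
      exact ⟨⟨x, y, hxy⟩, Subtype.ext (hfun _ _ _ (hf ⟨x, y, hxy⟩) hxy)⟩
  refine ⟨(Equiv.ofBijective F hF).extendSubtype, fun x y hxy => ?_⟩
  rw [Equiv.extendSubtype_apply_of_mem _ x ⟨y, hxy⟩]
  exact hfun _ _ _ (hf ⟨x, y, hxy⟩) hxy

/-- A related pair is coloured by the rank of each point in the other's neighbour list. Either point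
and the colour determine the other point, so each of the `k * k` colours is a partial injection. -/
theorem exists_perms_of_sparse_rel {X : Type} [Fintype X] {k : ℕ} {R : X → X → Prop}
    (hsymm : ∀ x y, R x y → R y x) {N : X → Finset X} (hN : ∀ x, (N x).card ≤ k)
    (hmem : ∀ x y, R x y → y ∈ N x) :
    ∃ π : Fin k × Fin k → Equiv.Perm X, ∀ x y, R x y → ∃ j, π j x = y := by
  let idx : ∀ x y, R x y → Fin k := fun x y h =>
    Fin.castLE (hN x) ((N x).equivFin ⟨y, hmem x y h⟩)
  have hidx : ∀ x y y' h h', idx x y h = idx x y' h' → y = y' := fun x y y' h h' he => by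
    have := (N x).equivFin.injective (Fin.castLE_injective _ he)
    exact congrArg Subtype.val this
  have hex := fun j : Fin k × Fin k => exists_perm_of_rel
    (fun x y => ∃ h : R x y, idx x y h = j.1 ∧ idx y x (hsymm _ _ h) = j.2)
    (fun x y y' ⟨h, h1, _⟩ ⟨h', h1', _⟩ => hidx x y y' h h' (h1.trans h1'.symm))
    (fun x x' y ⟨h, _, h2⟩ ⟨h', _, h2'⟩ => hidx y x x' (hsymm _ _ h) (hsymm _ _ h')
      (h2.trans h2'.symm))
  choose π hπ using hex
  exact ⟨π, fun x y h => ⟨(idx x y h, idx y x (hsymm _ _ h)), hπ _ x y ⟨h, rfl, rfl⟩⟩⟩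

/-! ### Matchings -/

section Matching

variable {Q V : Type} [Fintype Q] [DecidableEq Q] [Fintype V] [DecidableEq V]
  {G : SimpleGraph V} [DecidableRel G.Adj]

/-- A check with even `X`-type support on `L`, the ports of which are pairwise adjacent, is
matched by a star. -/
theorem exists_matching (L : Finset Q) (f : Q → V) (P : Pauli Q)
    (hnear : ∀ q ∈ L, ∀ q' ∈ L, P.1 q ≠ 0 → P.1 q' ≠ 0 → Near G (f q) (f q'))
    (heven : ∑ q ∈ L, P.1 q = 0) :
    ∃ c : G.edgeSet → ZMod 2, c ᵥ* incidence G = portMatrix L f *ᵥ P.1 ∧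
      (∀ e, c e ≠ 0 → ∀ v ∈ (e : Sym2 V), ∃ q ∈ L, P.1 q ≠ 0 ∧ f q = v) ∧
      {e | c e ≠ 0}.ncard ≤ weight P := by
  have hport : portMatrix L f *ᵥ P.1 = ∑ q ∈ L, P.1 q • Pi.single (f q) (1 : ZMod 2) := by
    ext v
    simp only [mulVec, dotProduct, portMatrix, Finset.sum_apply, Pi.smul_apply, smul_eq_mul,
      Pi.single_apply, ite_and, ite_mul, one_mul, zero_mul, mul_ite, mul_one, mul_zero]
    rw [Finset.sum_ite_mem, Finset.univ_inter]
    exact Finset.sum_congr rfl fun q _ => by simp only [eq_comm]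
  by_cases hne : ∃ q₀ ∈ L, P.1 q₀ ≠ 0
  · obtain ⟨q₀, hq₀, hP₀⟩ := hne
    have hc : ∀ e, (∑ q ∈ L, P.1 q • edgeVec G (f q₀) (f q)) e ≠ 0 →
        ∃ q ∈ L, P.1 q ≠ 0 ∧ (e : Sym2 V) = s(f q₀, f q) := by
      intro e he
      rw [Finset.sum_apply] at he
      obtain ⟨q, hq, hne⟩ := Finset.exists_ne_zero_of_sum_ne_zero he
      refine ⟨q, hq, fun h => hne (by simp [h]), ?_⟩
      by_contra h
      simp [edgeVec, h] at hne
    -- The star centred at one port: its boundary is the set of ports plus an even multiple of the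
    -- centre.
    refine ⟨∑ q ∈ L, P.1 q • edgeVec G (f q₀) (f q), ?_, fun e he v hv => ?_, ?_⟩
    · rw [hport, sum_vecMul]
      have : ∀ q ∈ L, (P.1 q • edgeVec G (f q₀) (f q)) ᵥ* incidence G =
          P.1 q • Pi.single (f q₀) (1 : ZMod 2) + P.1 q • Pi.single (f q) (1 : ZMod 2) := by
        intro q hq
        by_cases h : P.1 q = 0
        · simp [h]
        · rw [smul_vecMul, boundary_edgeVec (hnear q₀ hq₀ q hq hP₀ h), smul_add]
      rw [Finset.sum_congr rfl this, Finset.sum_add_distrib, ← Finset.sum_smul, heven, zero_smul,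
        zero_add]
    · obtain ⟨q, hq, hP, h⟩ := hc e he
      rw [h, Sym2.mem_iff] at hv
      rcases hv with rfl | rfl
      · exact ⟨q₀, hq₀, hP₀, rfl⟩
      · exact ⟨q, hq, hP, rfl⟩
    · rw [← Set.ncard_image_of_injective _ Subtype.val_injective]
      refine (Set.ncard_le_ncard (t := (fun q => s(f q₀, f q)) '' support P) ?_
        (Set.toFinite _)).trans (Set.ncard_image_le (Set.toFinite _))
      rintro _ ⟨e, he, rfl⟩
      obtain ⟨q, _, hP, h⟩ := hc e he
      exact ⟨q, Or.inl hP, h.symm⟩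
  · push Not at hne
    refine ⟨0, ?_, fun e he => absurd rfl he, by simp⟩
    rw [zero_vecMul, hport]
    exact (Finset.sum_eq_zero fun q hq => by rw [hne q hq, zero_smul]).symm

end Matching

/-! ### Sparsity of the deformed code -/

theorem ncard_sum_le {α β : Type} [Finite α] [Finite β] (s : Set (α ⊕ β)) :
    s.ncard ≤ (Sum.inl ⁻¹' s).ncard + (Sum.inr ⁻¹' s).ncard := by
  have h : s = Sum.inl '' (Sum.inl ⁻¹' s) ∪ Sum.inr '' (Sum.inr ⁻¹' s) := by
    ext (x | x) <;> simp
  conv_lhs => rw [h]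
  exact (Set.ncard_union_le _ _).trans
    (add_le_add (Set.ncard_image_le (Set.toFinite _)) (Set.ncard_image_le (Set.toFinite _)))

namespace JointSurgery

variable {Q S : Type} [Fintype Q] [DecidableEq Q] [Fintype S]
  {C : StabilizerCode Q S} {Ll Lr : Finset Q} (A : JointSurgery C Ll Lr)

theorem weight_withEdges (P : Pauli Q) (c : A.graph.edgeSet → ZMod 2) :
    weight (A.withEdges P c) = weight P + {e | c e ≠ 0}.ncard := by
  rw [weight_eq_leftPart_add_rightPart]
  congr 1
  rw [weight]
  congr 1
  ext e
  simp [support, rightPart, withEdges]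

theorem ports_apply_ne_zero {v : A.V} {q : Q} (h : A.ports v q ≠ 0) :
    (q ∈ Ll ∧ A.portL q = v) ∨ (q ∈ Lr ∧ A.portR q = v) := by
  by_contra! hcon
  refine h ?_
  change portMatrix Ll A.portL v q + portMatrix Lr A.portR v q = 0
  rw [portMatrix, portMatrix, if_neg fun h => hcon.1 h.1 h.2,
    if_neg fun h => hcon.2 h.1 h.2, add_zero]

theorem weight_vertexCheck_le (v : A.V) :
    weight (A.vertexCheck v) ≤ 2 + {e : A.graph.edgeSet | v ∈ (e : Sym2 A.V)}.ncard := by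
  rw [weight_eq_leftPart_add_rightPart]
  refine add_le_add ?_ (le_of_eq ?_)
  · have hsub : support (leftPart (A.vertexCheck v)) ⊆
        {q | q ∈ Ll ∧ A.portL q = v} ∪ {q | q ∈ Lr ∧ A.portR q = v} := by
      intro q hq
      refine A.ports_apply_ne_zero ?_
      simpa [support, leftPart, vertexCheck] using hq
    refine (Set.ncard_le_ncard hsub (Set.toFinite _)).trans ((Set.ncard_union_le _ _).trans ?_)
    refine add_le_add (b := 1) (d := 1) ?_ ?_
    · exact (Set.ncard_le_one (Set.toFinite _)).2 fun q hq q' hq' =>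
        A.portL_inj hq.1 hq'.1 (hq.2.trans hq'.2.symm)
    · exact (Set.ncard_le_one (Set.toFinite _)).2 fun q hq q' hq' =>
        A.portR_inj hq.1 hq'.1 (hq.2.trans hq'.2.symm)
  · rw [weight]
    congr 1
    ext e
    simp [support, rightPart, vertexCheck, incidence]

/-- The deformed code is sparse if the auxiliary graph has bounded degree, the matchings are small
and overlap boundedly, and the cycle basis is sparse. -/
theorem isLDPC_deformed {a b Δ μ ν γ κ : ℕ} (hC : C.IsLDPC a b)
    (hdeg : ∀ v, {e : A.graph.edgeSet | v ∈ (e : Sym2 A.V)}.ncard ≤ Δ)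
    (hμ : ∀ s, {e | A.matching s e ≠ 0}.ncard ≤ μ)
    (hν : ∀ e, {s | A.matching s e ≠ 0}.ncard ≤ ν)
    (hγ : ∀ u, {e | A.cycle u e ≠ 0}.ncard ≤ γ)
    (hκ : ∀ e, {u | A.cycle u e ≠ 0}.ncard ≤ κ) :
    A.deformed.IsLDPC (a + μ + Δ + γ + 2) (b + ν + κ + 2) := by
  constructor
  · rintro (s | v | u)
    · have h := A.weight_withEdges (C.check s) (A.matching s)
      have h1 := hC.1 s
      have h2 := hμ s
      change weight (A.withEdges (C.check s) (A.matching s)) ≤ _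
      omega
    · have h := A.weight_vertexCheck_le v
      have h1 := hdeg v
      change weight (A.vertexCheck v) ≤ _
      omega
    · have h := A.weight_withEdges 0 (A.cycle u)
      have h1 := hγ u
      have h0 : weight (0 : Pauli Q) = 0 := by simp [weight, support]
      change weight (A.withEdges 0 (A.cycle u)) ≤ _
      omega
  · rintro (q | e)
    · refine (ncard_sum_le _).trans ((add_le_add_right (ncard_sum_le _) _).trans ?_)
      have h1 : {s | Sum.inl q ∈ support (A.withEdges (C.check s) (A.matching s))}.ncard ≤ b :=
        hC.2 q
      have h2 : {v | Sum.inl q ∈ support (A.vertexCheck v)}.ncard ≤ 2 := by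
        refine (Set.ncard_le_ncard (t := {A.portL q, A.portR q}) ?_ (Set.toFinite _)).trans
          ((Set.ncard_insert_le _ _).trans (by simp))
        intro v hv
        have : A.ports v q ≠ 0 := by simpa [support, vertexCheck] using hv
        rcases A.ports_apply_ne_zero this with h | h
        · exact Or.inl h.2.symm
        · exact Or.inr h.2.symm
      have h3 : {u | Sum.inl q ∈ support (A.withEdges 0 (A.cycle u))}.ncard = 0 := by
        simp [support, withEdges]
      refine (add_le_add h1 (add_le_add h2 h3.le)).trans ?_
      omega
    · refine (ncard_sum_le _).trans ((add_le_add_right (ncard_sum_le _) _).trans ?_)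
      have h1 : {s | Sum.inr e ∈ support (A.withEdges (C.check s) (A.matching s))}.ncard ≤ ν := by
        simpa [support, withEdges] using hν e
      have h2 : {v | Sum.inr e ∈ support (A.vertexCheck v)}.ncard ≤ 2 := by
        obtain ⟨e, he⟩ := e
        induction e with | _ x y
        refine (Set.ncard_le_ncard (t := {x, y}) ?_ (Set.toFinite _)).trans
          ((Set.ncard_insert_le _ _).trans (by simp))
        intro v hv
        simpa [support, vertexCheck, incidence, or_iff_not_imp_left] using hv
      have h3 : {u | Sum.inr e ∈ support (A.withEdges 0 (A.cycle u))}.ncard ≤ κ := by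
        simpa [support, withEdges] using hκ e
      refine (add_le_add h1 (add_le_add h2 h3)).trans ?_
      omega

end JointSurgery

/-! ### Choice of ports, size estimate and assembly of the surgery -/

theorem exists_ports {Q X : Type} [DecidableEq Q] [Nonempty X] (B : Finset X) (L : Finset Q)
    (h : L.card ≤ B.card) : ∃ f : Q → X, Set.InjOn f L ∧ ∀ q ∈ L, f q ∈ B := by
  obtain ⟨g⟩ := Function.Embedding.nonempty_of_card_le (α := L) (β := B) (by simpa using h)
  refine ⟨fun q => if hq : q ∈ L then g ⟨q, hq⟩ else Classical.arbitrary X, ?_, ?_⟩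
  · intro q hq q' hq' he
    simp only [Finset.mem_coe] at hq hq'
    simp only [hq, hq', dif_pos] at he
    exact congrArg Subtype.val (g.injective (Subtype.ext he))
  · intro q hq
    simp only [hq, dif_pos]
    exact (g ⟨q, hq⟩).2

/-- The dimension of the cube is logarithmic in the number of ports. -/
theorem routing_size_le {D : ℕ} (hD : 1 ≤ D) :
    ((2 ^ Nat.clog 2 D * (Nat.clog 2 D + 1) : ℕ) : ℝ) ≤
      20 * D * Real.log ((D : ℝ) + 1) ^ 3 := by
  set m := Nat.clog 2 D with hm
  have hpow : 2 ^ m ≤ 2 * D := by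
    rcases Nat.lt_or_ge 1 D with h | h
    · have h1 := Nat.pow_pred_clog_lt_self (b := 2) one_lt_two h
      have h2 : 0 < m := Nat.clog_pos one_lt_two h
      rw [← hm, Nat.pred_eq_sub_one] at h1
      calc 2 ^ m = 2 * 2 ^ (m - 1) := by rw [← pow_succ', Nat.sub_add_cancel h2]
        _ ≤ 2 * D := by omega
    · have : m = 0 := by rw [hm]; exact Nat.clog_of_right_le_one h 2
      rw [this]; omega
  set l := Real.log ((D : ℝ) + 1) with hl
  have hD' : (1 : ℝ) ≤ D := by exact_mod_cast hD
  have hl2 : Real.log 2 ≤ l := Real.log_le_log two_pos (by linarith)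
  have hlog2 := Real.log_two_gt_d9
  have hml : (m : ℝ) * Real.log 2 ≤ Real.log 2 + l := by
    have h1 : ((2 ^ m : ℕ) : ℝ) ≤ 2 * (D + 1) := by
      have : ((2 ^ m : ℕ) : ℝ) ≤ ((2 * D : ℕ) : ℝ) := by exact_mod_cast hpow
      push_cast at this ⊢
      linarith
    have h2 := Real.log_le_log (by positivity) h1
    rw [Real.log_mul two_ne_zero (by positivity)] at h2
    push_cast at h2
    rwa [Real.log_pow] at h2
  have hlpos : (0.69 : ℝ) ≤ l := by linarith
  have hm1 : (m : ℝ) + 1 ≤ 10 * l ^ 3 := by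
    -- From `m ≤ 1 + l / log 2` and `1 ≤ l / 0.69`. The two further powers of `l` are gained at a
    -- constant factor, since `l` is bounded below.
    have h1 : (m : ℝ) + 1 ≤ 4.5 * l := by
      have hm0 : (0 : ℝ) ≤ m := by positivity
      by_contra! hcon
      nlinarith
    have h2 : (0.69 : ℝ) ^ 2 ≤ l ^ 2 := by gcongr
    have h3 : l * 0.69 ^ 2 ≤ l * l ^ 2 := by gcongr
    nlinarith
  have h2m : ((2 ^ m : ℕ) : ℝ) ≤ 2 * D := by exact_mod_cast hpow
  rw [Nat.cast_mul, Nat.cast_add, Nat.cast_one]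
  calc ((2 ^ m : ℕ) : ℝ) * ((m : ℝ) + 1) ≤ 2 * D * (10 * l ^ 3) := by gcongr
    _ = 20 * D * l ^ 3 := by ring

section Construction

variable {Q S : Type} [Fintype Q] [Fintype S] {C : StabilizerCode Q S} {a b : ℕ}

theorem ncard_checks_at_port_le (hC : C.IsLDPC a b) {V : Type} {L : Finset Q} {f : Q → V}
    (hf : Set.InjOn f L) (v : V) :
    {s | ∃ q ∈ L, q ∈ support (C.check s) ∧ f q = v}.ncard ≤ b := by
  by_cases h : ∃ q ∈ L, f q = v
  · obtain ⟨q, hq, rfl⟩ := h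
    refine (Set.ncard_le_ncard ?_ (Set.toFinite _)).trans (hC.2 q)
    rintro s ⟨q', hq', hs, hqq⟩
    rw [hf hq' hq hqq] at hs
    exact hs
  · have : {s | ∃ q ∈ L, q ∈ support (C.check s) ∧ f q = v} = ∅ := by
      ext s
      simp only [Set.mem_ofPred_eq, Set.mem_empty_iff_false, iff_false]
      rintro ⟨q, hq, -, hqv⟩
      exact h ⟨q, hq, hqv⟩
    simp [this]

/-- Ports that must be adjacent: the ports of two qubits of `L` on which the same check acts as
`X` or `Y`. -/
def PortRel {V : Type} (C : StabilizerCode Q S) (L : Finset Q) (f : Q → V) (v w : V) : Prop :=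
  ∃ s, ∃ q ∈ L, ∃ q' ∈ L, (C.check s).1 q ≠ 0 ∧ (C.check s).1 q' ≠ 0 ∧ f q = v ∧ f q' = w

-- A port serves one qubit of `L`, which lies in at most `b` checks of weight at most `a`, so it has
-- at most `b * a` related ports.
open Classical in
theorem exists_perms_of_portRel (hC : C.IsLDPC a b) {V : Type} [Fintype V] {L : Finset Q}
    {f : Q → V} (hf : Set.InjOn f L) :
    ∃ π : Fin (b * a) × Fin (b * a) → Equiv.Perm V,
      ∀ v w, PortRel C L f v w → ∃ j, π j v = w := by
  refine exists_perms_of_sparse_rel (N := fun v =>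
    (Finset.univ.filter fun s => ∃ q ∈ L, q ∈ support (C.check s) ∧ f q = v).biUnion fun s =>
      (support (C.check s)).toFinset.image f) ?_ (fun v => ?_) ?_
  · rintro v w ⟨s, q, hq, q', hq', h, h', hv, hw⟩
    exact ⟨s, q', hq', q, hq, h', h, hw, hv⟩
  · refine (Finset.card_biUnion_le_card_mul _ _ a fun s _ => ?_).trans
      (Nat.mul_le_mul_right a ?_)
    · refine Finset.card_image_le.trans ?_
      rw [← Set.ncard_eq_toFinset_card']
      exact hC.1 s
    · refine le_of_eq_of_le ?_ (ncard_checks_at_port_le hC hf v)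
      rw [← Set.ncard_coe_finset]
      congr 1
      ext s
      simp
  · rintro v w ⟨s, q, hq, q', hq', h, h', hv, hw⟩
    exact Finset.mem_biUnion.2 ⟨s, Finset.mem_filter.2 ⟨Finset.mem_univ _, q, hq, Or.inl h, hv⟩,
      Finset.mem_image.2 ⟨q', Set.mem_toFinset.2 (Or.inl h'), hw⟩⟩

variable [DecidableEq Q]

theorem sum_check_eq_zero {L : Finset Q} (hL : C.IsLogical (zOn L)) (s : S) :
    ∑ q ∈ L, (C.check s).1 q = 0 := by
  have h := hL s
  simpa [symp, zOn] using h

variable {Ll Lr : Finset Q}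

/-- Surgery with an auxiliary graph of bounded degree whose cycles are generated by short ones and
in which the ports of the qubits in a common check are adjacent. -/
theorem exists_jointSurgery_of_graph {V : Type} [Fintype V] [DecidableEq V] {G : SimpleGraph V}
    [DecidableRel G.Adj] (hconn : G.Connected) (hfill : IsFilled G) {Δ : ℕ} {N : V → Finset V}
    (hN : ∀ v, (N v).card ≤ Δ) (hmem : ∀ u v, G.Adj u v → v ∈ N u) (hC : C.IsLDPC a b)
    (hl : C.IsLogical (zOn Ll)) (hr : C.IsLogical (zOn Lr)) {fl fr : Q → V}
    (hfl : Set.InjOn fl Ll) (hfr : Set.InjOn fr Lr)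
    (hnl : ∀ v w, PortRel C Ll fl v w → Near G v w)
    (hnr : ∀ v w, PortRel C Lr fr v w → Near G v w)
    {B : Finset V} (hBl : ∀ q ∈ Ll, fl q ∈ B) (hBr : ∀ q ∈ Lr, fr q ∈ B) :
    ∃ A : JointSurgery C Ll Lr, A.MeasuresOnlyProduct ∧
      A.deformed.IsLDPC (a + (a + a) + Δ + 4 + 2) (b + (b + b) + (Δ + 1) ^ 2 + 2) ∧
      A.size ≤ Fintype.card V * (Δ + 1) ∧
      ∃ B' : Finset A.V, B'.card = B.card ∧ (∀ q ∈ Ll, A.portL q ∈ B') ∧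
        ∀ q ∈ Lr, A.portR q ∈ B' := by
  classical
  have match_of : ∀ (L : Finset Q) (f : Q → V), C.IsLogical (zOn L) →
      (∀ v w, PortRel C L f v w → Near G v w) → ∀ s, ∃ c : G.edgeSet → ZMod 2,
      c ᵥ* incidence G = portMatrix L f *ᵥ (C.check s).1 ∧
      (∀ e, c e ≠ 0 → ∀ v ∈ (e : Sym2 V), ∃ q ∈ L, (C.check s).1 q ≠ 0 ∧ f q = v) ∧
      {e | c e ≠ 0}.ncard ≤ weight (C.check s) := fun L f hL hn s =>
    exists_matching L f (C.check s)
      (fun q hq q' hq' h h' => hn _ _ ⟨s, q, hq, q', hq', h, h', rfl, rfl⟩)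
      (sum_check_eq_zero hL s)
  choose cl hcl1 hcl2 hcl3 using match_of Ll fl hl hnl
  choose cr hcr1 hcr2 hcr3 using match_of Lr fr hr hnr
  have match_zero : ∀ (L : Finset Q) (f : Q → V) (s : S) (c : G.edgeSet → ZMod 2),
      (∀ e, c e ≠ 0 → ∀ v ∈ (e : Sym2 V), ∃ q ∈ L, (C.check s).1 q ≠ 0 ∧ f q = v) →
      (∀ q ∈ L, (C.check s).1 q = 0) → c = 0 := by
    intro L f s c hc hL
    ext e
    by_contra he
    obtain ⟨q, hq, hne, -⟩ := hc e he _ (Sym2.out_fst_mem e.1)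
    exact hne (hL q hq)
  have match_count : ∀ (L : Finset Q) (f : Q → V), Set.InjOn f L →
      ∀ c : S → G.edgeSet → ZMod 2,
      (∀ s e, c s e ≠ 0 → ∀ v ∈ (e : Sym2 V), ∃ q ∈ L, (C.check s).1 q ≠ 0 ∧ f q = v) →
      ∀ e, {s | c s e ≠ 0}.ncard ≤ b := by
    intro L f hf c hc e
    refine (Set.ncard_le_ncard ?_ (Set.toFinite _)).trans
      (ncard_checks_at_port_le hC hf (Quot.out e.1).1)
    intro s hs
    obtain ⟨q, hq, hne, hv⟩ := hc s e hs _ (Sym2.out_fst_mem e.1)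
    exact ⟨q, hq, Or.inl hne, hv⟩
  -- The cycle basis is selected among the short closed walks and inherits both of their sparsity
  -- bounds.
  obtain ⟨U, hU, hspan, hind⟩ := exists_linearIndependent (ZMod 2) (quads G)
  have : Fintype U := Fintype.ofFinite U
  let A : JointSurgery C Ll Lr :=
    { V := V
      graph := G
      connected := hconn
      portL := fl
      portR := fr
      portL_inj := hfl
      portR_inj := hfr
      -- Each operator is matched separately, which is possible because each alone is logical and so
      -- meets every check evenly.
      matching := fun s => cl s + cr s
      matching_boundary := fun s => by rw [add_vecMul, hcl1, hcr1, add_mulVec]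
      matching_eq_zero := fun s hs => by
        rw [match_zero Ll fl s _ (hcl2 s) fun q hq => hs q (Finset.mem_union_left _ hq),
          match_zero Lr fr s _ (hcr2 s) fun q hq => hs q (Finset.mem_union_right _ hq), add_zero]
      U := U
      cycle := Subtype.val
      cycle_independent := hind
      cycle_span := fun c => by
        rw [Subtype.range_coe, hspan, span_quads hfill]
        rfl }
  have hsub : ∀ x y : G.edgeSet → ZMod 2, {e | (x + y) e ≠ 0} ⊆ {e | x e ≠ 0} ∪ {e | y e ≠ 0} := by
    intro x y e he
    by_contra h
    simp only [Set.mem_union, Set.mem_ofPred_eq, not_or, not_not] at h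
    exact he (by rw [Pi.add_apply, h.1, h.2, add_zero])
  refine ⟨A, A.measuresOnlyProduct hl hr, A.isLDPC_deformed hC
    (fun v => ncard_incident_le hN hmem v) (fun s => ?_) (fun e => ?_)
    (fun u => ncard_quad_le (hU u.2)) (fun e => ?_), ?_, B, rfl, hBl, hBr⟩
  · refine (Set.ncard_le_ncard (hsub (cl s) (cr s)) (Set.toFinite _)).trans
      ((Set.ncard_union_le _ _).trans ?_)
    exact add_le_add ((hcl3 s).trans (hC.1 s)) ((hcr3 s).trans (hC.1 s))
  · refine (Set.ncard_le_ncard (t := {s | cl s e ≠ 0} ∪ {s | cr s e ≠ 0})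
      (fun s hs => hsub (cl s) (cr s) hs) (Set.toFinite _)).trans
      ((Set.ncard_union_le _ _).trans ?_)
    exact add_le_add (match_count Ll fl hfl cl hcl2 e) (match_count Lr fr hfr cr hcr2 e)
  · refine le_trans ?_ (ncard_quads_through_le hN hmem e)
    rw [← Set.ncard_image_of_injective _ Subtype.val_injective]
    refine Set.ncard_le_ncard ?_ (Set.toFinite _)
    rintro _ ⟨u, hu, rfl⟩
    exact ⟨hU u.2, hu⟩
  · have h := card_edgeSet_le hN hmem
    change Fintype.card V + Fintype.card G.edgeSet ≤ _
    rw [mul_add, mul_one, add_comm]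
    exact Nat.add_le_add_right h _

/-- The degree of the auxiliary graph. -/
def auxDegree (a b : ℕ) : ℕ := 4 * (b * a * (b * a) + b * a * (b * a)) + 5

/-- Both port functions go into one set `B` of exactly `D` vertices in the last layer, where the
stages equal the prescribed permutations. The size of `B` is what the distance bound loses. -/
theorem exists_jointSurgery (hC : C.IsLDPC a b) (hl : C.IsLogical (zOn Ll))
    (hr : C.IsLogical (zOn Lr)) (hD : 1 ≤ max Ll.card Lr.card) :
    ∃ A : JointSurgery C Ll Lr, A.MeasuresOnlyProduct ∧
      A.deformed.IsLDPC (a + (a + a) + auxDegree a b + 4 + 2)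
        (b + (b + b) + (auxDegree a b + 1) ^ 2 + 2) ∧
      (A.size : ℝ) ≤ 20 * (auxDegree a b + 1) * (max Ll.card Lr.card : ℕ) *
        Real.log ((max Ll.card Lr.card : ℕ) + 1) ^ 3 ∧
      ∃ B : Finset A.V, B.card = max Ll.card Lr.card ∧ (∀ q ∈ Ll, A.portL q ∈ B) ∧
        ∀ q ∈ Lr, A.portR q ∈ B := by
  classical
  set D := max Ll.card Lr.card
  set m := Nat.clog 2 D with hm
  have hcard : Fintype.card (Cube m) = 2 ^ m := by simp
  obtain ⟨B, -, hB⟩ := Finset.exists_subset_card_eq (s := (Finset.univ : Finset (Cube m)))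
    (n := D) (by rw [Finset.card_univ, hcard]; exact Nat.le_pow_clog one_lt_two D)
  obtain ⟨fl, hfl, hBl⟩ := exists_ports B Ll (hB ▸ le_max_left _ _)
  obtain ⟨fr, hfr, hBr⟩ := exists_ports B Lr (hB ▸ le_max_right _ _)
  obtain ⟨πl, hπl⟩ := exists_perms_of_portRel hC hfl
  obtain ⟨πr, hπr⟩ := exists_perms_of_portRel hC hfr
  obtain ⟨G, hconn, hfill, hdeg, hnear⟩ := Cube.exists_routingGraph m (Sum.elim πl πr)
  choose N hN hmem using hdeg
  have hinj : Function.Injective fun x : Cube m => (x, Fin.last m) := fun x y h =>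
    congrArg Prod.fst h
  have hport : ∀ (L : Finset Q) (f : Q → Cube m),
      (∀ x y, PortRel C L f x y → ∃ j, Sum.elim πl πr j x = y) →
      ∀ v w, PortRel C L (fun q => (f q, Fin.last m)) v w → Near G v w := by
    rintro L f h v w ⟨s, q, hq, q', hq', hs, hs', rfl, rfl⟩
    obtain ⟨j, hj⟩ := h _ _ ⟨s, q, hq, q', hq', hs, hs', rfl, rfl⟩
    change Near G (f q, Fin.last m) (f q', Fin.last m)
    rw [← hj]
    exact hnear j _
  have hΔ : 4 * Fintype.card (Fin (b * a) × Fin (b * a) ⊕ Fin (b * a) × Fin (b * a)) + 5 =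
      auxDegree a b := by simp [auxDegree]
  rw [hΔ] at hN
  obtain ⟨A, h1, h2, h3, B', hB', h4, h5⟩ := exists_jointSurgery_of_graph hconn hfill hN hmem hC
    hl hr (hinj.comp_injOn hfl) (hinj.comp_injOn hfr)
    (hport Ll fl fun x y h => (hπl x y h).imp' Sum.inl fun _ h => h)
    (hport Lr fr fun x y h => (hπr x y h).imp' Sum.inr fun _ h => h)
    (B := B.image fun x => (x, Fin.last m))
    (fun q hq => Finset.mem_image_of_mem _ (hBl q hq))
    (fun q hq => Finset.mem_image_of_mem _ (hBr q hq))
  refine ⟨A, h1, h2, ?_, B', ?_, h4, h5⟩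
  · have h6 := routing_size_le hD
    have h7 : (A.size : ℝ) ≤ ((2 ^ m * (m + 1) : ℕ) : ℝ) * (auxDegree a b + 1) := by
      rw [Fintype.card_prod, hcard, Fintype.card_fin] at h3
      exact_mod_cast h3
    calc (A.size : ℝ) ≤ _ := h7
      _ ≤ (20 * D * Real.log ((D : ℝ) + 1) ^ 3) * (auxDegree a b + 1) := by gcongr
      _ = _ := by ring
  · rw [hB', Finset.card_image_of_injective _ hinj, hB]

end Construction

theorem one_le_card_of_isNontrivialLogical {Q S : Type} [Fintype Q] [DecidableEq Q] [Fintype S]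
    {C : StabilizerCode Q S} {L : Finset Q} (h : C.IsNontrivialLogical (zOn L)) :
    1 ≤ L.card := by
  rw [Nat.one_le_iff_ne_zero, Finset.card_ne_zero, Finset.nonempty_iff_ne_empty]
  rintro rfl
  refine h.2 ?_
  convert! C.stabilizer.zero_mem

end QSurgery

theorem theorem5 (a b : ℕ) :
    ∃ (K : ℝ) (a' b' : ℕ),
      -- the two operators may belong to the same code
      (∀ (Q S : Type) [Fintype Q] [DecidableEq Q] [Fintype S]
        (C : QSurgery.StabilizerCode Q S) (Ll Lr : Finset Q),
        C.IsLDPC a b →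
        C.IsNontrivialLogical (QSurgery.zOn Ll) →
        C.IsNontrivialLogical (QSurgery.zOn Lr) →
        ∃ A : QSurgery.JointSurgery C Ll Lr,
          A.MeasuresOnlyProduct ∧
          A.deformed.IsLDPC a' b' ∧
          (A.size : ℝ) ≤ K * (max Ll.card Lr.card : ℕ) *
            Real.log ((max Ll.card Lr.card : ℕ) + 1) ^ 3) ∧
      -- the two operators belong to separate codeblocks
      (∀ (Ql Sl Qr Sr : Type) [Fintype Ql] [DecidableEq Ql] [Fintype Sl]
        [Fintype Qr] [DecidableEq Qr] [Fintype Sr]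
        (Cl : QSurgery.StabilizerCode Ql Sl) (Cr : QSurgery.StabilizerCode Qr Sr)
        (Ll : Finset Ql) (Lr : Finset Qr),
        Cl.IsLDPC a b →
        Cr.IsLDPC a b →
        Cl.IsNontrivialLogical (QSurgery.zOn Ll) →
        Cr.IsNontrivialLogical (QSurgery.zOn Lr) →
        ∃ A : QSurgery.JointSurgery (Cl.sum Cr)
            (Ll.map Function.Embedding.inl) (Lr.map Function.Embedding.inr),
          A.MeasuresOnlyProduct ∧
          A.deformed.IsLDPC a' b' ∧
          (A.size : ℝ) ≤ K * (max Ll.card Lr.card : ℕ) *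
            Real.log ((max Ll.card Lr.card : ℕ) + 1) ^ 3 ∧
          (Cl.distance : ℤ) + Cr.distance - (max Ll.card Lr.card : ℕ) ≤ A.deformed.distance ∧
          -- the heavier operator has minimum weight in its code
          ((Lr.card ≤ Ll.card ∧ Ll.card = Cl.distance) ∨
              (Ll.card ≤ Lr.card ∧ Lr.card = Cr.distance) →
            min Cl.distance Cr.distance ≤ A.deformed.distance)) := by

  refine ⟨20 * (QSurgery.auxDegree a b + 1),
    a + (a + a) + QSurgery.auxDegree a b + 4 + 2,
    b + (b + b) + (QSurgery.auxDegree a b + 1) ^ 2 + 2, ?_, ?_⟩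
  · intro Q S _ _ _ C Ll Lr hC hl hr
    obtain ⟨A, h1, h2, h3, -⟩ := QSurgery.exists_jointSurgery hC hl.1 hr.1
      ((QSurgery.one_le_card_of_isNontrivialLogical hl).trans (le_max_left _ _))
    exact ⟨A, h1, h2, h3⟩
  · intro Ql Sl Qr Sr _ _ _ _ _ _ Cl Cr Ll Lr hCl hCr hl hr
    obtain ⟨A, h1, h2, h3, B, hB, hBl, hBr⟩ := QSurgery.exists_jointSurgery
      (QSurgery.isLDPC_sum hCl hCr) (QSurgery.isLogical_zOn_inl (C₂ := Cr) hl.1)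
      (QSurgery.isLogical_zOn_inr (C₁ := Cl) hr.1) (by
        rw [Finset.card_map, Finset.card_map]
        exact (QSurgery.one_le_card_of_isNontrivialLogical hl).trans (le_max_left _ _))
    rw [Finset.card_map, Finset.card_map] at h3 hB
    have hdist := A.distance_add_distance_le hl hr
      (fun q hq => hBl _ (Finset.mem_map_of_mem _ hq))
      (fun q hq => hBr _ (Finset.mem_map_of_mem _ hq))
    rw [hB] at hdist
    refine ⟨A, h1, h2, h3, by omega, ?_⟩
    -- When `D` is one of the two distances, the bound `dₗ + dᵣ - D` is the other one.
    rintro (⟨h, h'⟩ | ⟨h, h'⟩) <;> omega
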